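/- **Setting.** Let $K\ge 1$ be the number of arms and $T$ the number of rounds. In each round $t=1,\dots,T$ the environment chooses a loss vector $\ell^t\in[0,1]^K$ (possibly at random and depending on the past) while, simultaneously, the learner picks an arm $i^t\in[K]$ to exploit and an arm $j^t\in[K]$ to explore; the learner suffers $\ell^t_{i^t}$ and observes $\ell^t_{j^t}$ only. Let $i^\star\in\operatorname{argmin}_{i\in[K]}\mathbb E\big[\sum_{t=1}^T\ell^t_i\big]$ and $$\mathrm{Reg}^T=\mathbb E\Big[\sum_{t=1}^T\ell^t_{i^t}-\sum_{t=1}^T\ell^t_{i^\star}\Big].$$ **Algorithm.** In round $t$ the learner computes $$p^t=\operatorname*{argmin}_{p\in\Omega_K}\Big\{\Big\langle p,\sum_{\tau<t}\widehat\ell^\tau\Big\rangle-\frac{1}{1-\beta}\sum_{i\in[K]}\gamma^t p_i^{\beta}\Big\},\qquad \beta=\tfrac23,\quad \gamma^t=K^{1/6}\sqrt t,$$ where $\Omega_K$ is the probability simplex. Given the history before round $t$ and $\ell^t$, the arm $i^t$ is drawn from $p^t$ and the arm $j^t$ from $g^t$, where $g^t_i=(p^t_i)^{2/3}/\sum_{k\in[K]}(p^t_k)^{2/3}$.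 The loss estimator is $\widehat\ell^t_i=\mathbb 1\{j^t=i\}\,\ell^t_i/g^t_i$. **Theorem.** There is a universal constant $c>0$ such that, for all $K$, $T$ and every environment, the algorithm satisfies $$\mathrm{Reg}^T\le c\sqrt{KT},$$ and simultaneously the following holds. Let $\Delta\in[0,1]^K$ and $C\ge 0$ be such that $$\mathrm{Reg}^T\ \ge\ \mathbb E\Big[\sum_{t=1}^T\sum_{i\in[K]}p^t_i\,\Delta_i\Big]-C ,$$ let $V=\{i:\Delta_i\ne 0\}$, and let $D$ be such that $$\mathbb E\Big[\sum_{t=1}^T\max_{i:\Delta_i=0}\mathbb E^t\big[\ell^t_i-\ell^t_{i^\star}\big]\Big]\le D,$$ where $\mathbb E^t$ is the conditional expectation given the history before round $t$ (a maximum over the empty set is read as $0$). Then $$\mathrm{Reg}^T\le c\left(\sqrt{\sum_{i\in V}\frac{K}{\Delta_i^2}}+\sqrt C\,\Big(\sum_{i\in V}\frac{K}{\Delta_i^2}\Big)^{1/4}+K+D\right).$$ No uniqueness of an arm with $\Delta_i=0$ is assumed. -/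

import Mathlib

open MeasureTheory ProbabilityTheory

noncomputable section

namespace DEE

/-! Rounds are indexed from `0`: index `t : ℕ` stands for round `t + 1`, and a horizon of `T` rounds
is `Finset.range T`. The arms are `Fin K`, with `K ≥ 1`. -/

/-- The Tsallis entropy regularizer `-(1 / (1 - β)) ∑ᵢ γᵢ pᵢ ^ β`. -/
def tsallis {K : ℕ} (β : ℝ) (γ : Fin K → ℝ) (p : Fin K → ℝ) : ℝ :=
  -(1 / (1 - β)) * ∑ i, γ i * p i ^ β

/-- The learning rate of round `t + 1`: `K ^ (1/6) * √(t + 1)`, the same for all arms. -/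
def rate (K t : ℕ) : ℝ := (K : ℝ) ^ (1 / 6 : ℝ) * √((t : ℝ) + 1)

/-- The FTRL objective `⟨p, L⟩ + φ(p)` of round `t + 1`, where `L` is the cumulative loss estimate
and `φ` is the `2/3`-Tsallis entropy with the learning rate of that round. -/
def objective {K : ℕ} (t : ℕ) (L p : Fin K → ℝ) : ℝ :=
  ∑ i, p i * L i + tsallis (2 / 3) (fun _ => rate K t) p

theorem exists_objective_min {K : ℕ} [NeZero K] (t : ℕ) (L : Fin K → ℝ) :
    ∃ p ∈ stdSimplex ℝ (Fin K), IsMinOn (objective t L) (stdSimplex ℝ (Fin K)) p := by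
  refine (isCompact_stdSimplex ℝ (Fin K)).exists_isMinOn
    ⟨_, single_mem_stdSimplex ℝ (0 : Fin K)⟩ (Continuous.continuousOn ?_)
  unfold objective tsallis
  refine Continuous.add (by fun_prop) (Continuous.mul continuous_const ?_)
  refine continuous_finsetSum _ fun i _ => Continuous.mul continuous_const ?_
  exact (continuous_apply i).rpow_const fun _ => Or.inr (by norm_num)

/-- The exploitation distribution: the minimizer over the simplex of the FTRL objective (which is
strictly convex there, so that the minimizer is unique). -/
def ftrl {K : ℕ} [NeZero K] (t : ℕ) (L : Fin K → ℝ) : Fin K → ℝ :=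
  (exists_objective_min t L).choose

/-- The exploration distribution `gᵢ = pᵢ ^ (2/3) / ∑ⱼ pⱼ ^ (2/3)`. -/
def explore {K : ℕ} (p : Fin K → ℝ) (i : Fin K) : ℝ :=
  p i ^ (2 / 3 : ℝ) / ∑ j, p j ^ (2 / 3 : ℝ)

/-- The cumulative loss estimate before round `t + 1`, computed from the explored arms `j` and the
observed feedback `y` (where `y s` is the loss of arm `j s` in that round): the sum over the previous
rounds of the importance-weighted estimators `𝟙{j s = i} * y s / g i`. -/
def cumEst {K : ℕ} [NeZero K] (j : ℕ → Fin K) (y : ℕ → ℝ) : ℕ → Fin K → ℝ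
  | 0 => fun _ => 0
  | t + 1 => fun i =>
      cumEst j y t i + if j t = i then y t / explore (ftrl t (cumEst j y t)) i else 0

/-- The distribution `p` from which the learner draws the exploitation arm of round `t + 1`. -/
def exploitDist {K : ℕ} [NeZero K] (j : ℕ → Fin K) (y : ℕ → ℝ) (t : ℕ) : Fin K → ℝ :=
  ftrl t (cumEst j y t)

variable {Ω : Type*} [MeasurableSpace Ω]

/-- `T` rounds of the decoupled bandit problem in which the learner uses the above algorithm,
against an arbitrary (randomized, adaptive) environment.

* `loss t ω` is the loss vector of round `t + 1`, `I t ω` the arm that is exploited and `J t ω` the arm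
  that is explored in that round; the learner observes `loss t ω (J t ω)`.
* `𝓕 t` is the history before round `t + 1`. It contains the arms and the feedback of the previous
  rounds, and may contain more (such as all previous loss vectors, or the state of the environment).
* The environment chooses the loss vector simultaneously with the learner: given the history and the
  current loss vector, `I t` is distributed according to `p` and `J t` according to `g ∝ p ^ (2/3)`.
  The two draws may be coupled in any way, in particular they may be independent. -/
structure IsRun {K : ℕ} [NeZero K] (μ : Measure Ω) (T : ℕ) (𝓕 : Filtration ℕ ‹MeasurableSpace Ω›)
    (loss : ℕ → Ω → Fin K → ℝ) (I J : ℕ → Ω → Fin K) : Prop where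
  measurable_loss : ∀ t < T, Measurable (loss t)
  loss_mem : ∀ t < T, ∀ ω i, loss t ω i ∈ Set.Icc (0 : ℝ) 1
  measurable_exploit : ∀ t < T, Measurable (I t)
  measurable_explore : ∀ t < T, Measurable (J t)
  history_exploit : ∀ t < T, ∀ s < t, Measurable[𝓕 t] (I s)
  history_explore : ∀ t < T, ∀ s < t, Measurable[𝓕 t] (J s)
  history_feedback : ∀ t < T, ∀ s < t, Measurable[𝓕 t] (fun ω => loss s ω (J s ω))
  law_exploit : ∀ t < T, ∀ i,
    μ[(I t ⁻¹' {i}).indicator (fun _ => (1 : ℝ)) | 𝓕 t ⊔ MeasurableSpace.comap (loss t) inferInstance]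
      =ᵐ[μ] fun ω => exploitDist (fun s => J s ω) (fun s => loss s ω (J s ω)) t i
  law_explore : ∀ t < T, ∀ i,
    μ[(J t ⁻¹' {i}).indicator (fun _ => (1 : ℝ)) | 𝓕 t ⊔ MeasurableSpace.comap (loss t) inferInstance]
      =ᵐ[μ] fun ω => explore (exploitDist (fun s => J s ω) (fun s => loss s ω (J s ω)) t) i

/-- `i` is a best fixed arm in hindsight: it minimizes the expected cumulative loss. -/
def IsBestArm {K : ℕ} (μ : Measure Ω) (T : ℕ) (loss : ℕ → Ω → Fin K → ℝ) (i : Fin K) : Prop :=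
  ∀ k, ∫ ω, ∑ t ∈ Finset.range T, loss t ω i ∂μ ≤ ∫ ω, ∑ t ∈ Finset.range T, loss t ω k ∂μ

/-- The (pseudo-)regret of the exploited arms with respect to the fixed arm `i`. -/
def regret {K : ℕ} (μ : Measure Ω) (T : ℕ) (loss : ℕ → Ω → Fin K → ℝ) (I : ℕ → Ω → Fin K)
    (i : Fin K) : ℝ :=
  ∫ ω, (∑ t ∈ Finset.range T, loss t ω (I t ω) - ∑ t ∈ Finset.range T, loss t ω i) ∂μ

/-- The self-bounding condition with gap vector `Δ` and corruption `C`: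
`Reg ≥ 𝔼[∑ₜ ∑ᵢ pᵗᵢ Δᵢ] - C`, where `i` is the best arm with which the regret is taken. -/
def SelfBounding {K : ℕ} [NeZero K] (μ : Measure Ω) (T : ℕ) (loss : ℕ → Ω → Fin K → ℝ)
    (I J : ℕ → Ω → Fin K) (i : Fin K) (Δ : Fin K → ℝ) (C : ℝ) : Prop :=
  ∫ ω, ∑ t ∈ Finset.range T, ∑ k,
      exploitDist (fun s => J s ω) (fun s => loss s ω (J s ω)) t k * Δ k ∂μ - C
    ≤ regret μ T loss I i

/-- `𝔼[∑ₜ max_{k : Δₖ = 0} 𝔼[ℓᵗₖ - ℓᵗᵢ | history before the round]]`; the maximum is read as `0`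
if no arm has gap zero. -/
def zeroGapDeviation {K : ℕ} (μ : Measure Ω) (T : ℕ) (𝓕 : Filtration ℕ ‹MeasurableSpace Ω›)
    (loss : ℕ → Ω → Fin K → ℝ) (i : Fin K) (Δ : Fin K → ℝ) : ℝ :=
  ∫ ω, ∑ t ∈ Finset.range T,
    ⨆ k : {k : Fin K // Δ k = 0}, (μ[fun ω' => loss t ω' k - loss t ω' i | 𝓕 t]) ω ∂μ

/-- The complexity `∑_{i : Δᵢ ≠ 0} K / Δᵢ ^ 2`. -/
def complexity {K : ℕ} (Δ : Fin K → ℝ) : ℝ :=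
  ∑ i with Δ i ≠ 0, (K : ℝ) / Δ i ^ 2

end DEE

end

/-! Write `pᵢ = uᵢ³`. The optimality condition of FTRL on the face of the simplex over a set of arms
reads `uᵢ = 2γ / (Lᵢ - l)`, where the multiplier `l` makes the weights sum to one. Estimates on FTRL
thus reduce to estimates on one scalar and on the convex function `s ↦ (2γ / s)³`. The exploration
probability of arm `i` is `uᵢ² / ∑ uₖ²`.

The standard analysis charges a round with `κ t^(-1/2) ∑ uᵢ²`, `κ = K^(1/6)`, over all arms but one,
which is too much when several arms have gap zero. Hence the algorithm is compared with FTRL on the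
face over the set `U` of gap-zero arms, fed with the same estimates (over `{iStar}` if there are
none). The distribution `q` of the latter is known before the round and lives on `U`, so its own
regret is at most `D` (`sum_integral_weight_mul_le`).

The cost of playing `p` instead of `q` is controlled by telescoping the difference of the two
optimal values, which is nonpositive. What remains are differences of penalty terms and of stability
terms, in which the arms of `U` nearly cancel. A stability term is the integral of the drop of the
weight of the explored arm while its loss estimate grows; conservation of total mass on both faces
shows that the two drops differ by little (`weight_drop_sub_mul_le`). This needs a multiplier shift
of at most `γ`, which holds from round `K` on (`shift_condition`); the earlier rounds cost `O(K)`.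
After averaging over the explored arm, only `∑ uᵢ²` over the arms outside `U` survives
(`sum_integral_weight_sub_le`).

With `U = {iStar}` this gives `√(KT)`. For the second bound, a fraction `η` of the self-bounding
condition is subtracted: per arm, `b u² - η Δᵢ u³ ≤ b³ / (η Δᵢ)²` with `b` of order `κ t^(-1/2)`.
Summing the minimum of the resulting `t^(-3/2)` bound and the trivial `t^(-1/2)` bound gives
`√complexity / η` (`sum_sub_gap_le`), and `η` is then optimized. -/

noncomputable section

namespace DEE

/-! ### Tsallis FTRL on faces of the simplex: multiplier, weights and optimal value. -/

section Multiplier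

variable {ι : Type*}

/-- Intermediate value theorem between `min L - 2γ|U|`, where every term is at most `1 / |U|`, and
`min L - 2γ`, where the minimal arm alone contributes `1`. -/
theorem exists_multiplier {U : Finset ι} (hU : U.Nonempty) {γ : ℝ} (hγ : 0 < γ) (L : ι → ℝ) :
    ∃ l, (∀ i ∈ U, l < L i) ∧ ∑ i ∈ U, (2 * γ / (L i - l)) ^ 3 = 1 := by
  obtain ⟨k, hk, hmin⟩ := U.exists_min_image L hU
  have hc : (1 : ℝ) ≤ U.card := by exact_mod_cast hU.card_pos
  have hlt : ∀ l ∈ Set.Icc (L k - 2 * γ * U.card) (L k - 2 * γ), ∀ i ∈ U, 0 < L i - l := by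
    intro l hl i hi
    linarith [hmin i hi, hl.2]
  have hcont : ContinuousOn (fun l => ∑ i ∈ U, (2 * γ / (L i - l)) ^ 3)
      (Set.Icc (L k - 2 * γ * U.card) (L k - 2 * γ)) := by
    refine continuousOn_finsetSum _ fun i hi => ContinuousOn.pow ?_ 3
    exact continuousOn_const.div (by fun_prop) fun l hl => (hlt l hl i hi).ne'
  have hle : L k - 2 * γ * U.card ≤ L k - 2 * γ := by nlinarith
  suffices h : (1 : ℝ) ∈ Set.Icc (∑ i ∈ U, (2 * γ / (L i - (L k - 2 * γ * U.card))) ^ 3)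
      (∑ i ∈ U, (2 * γ / (L i - (L k - 2 * γ))) ^ 3) by
    obtain ⟨l, hl, h1⟩ := intermediate_value_Icc hle hcont h
    exact ⟨l, fun i hi => by linarith [hlt l hl i hi], h1⟩
  constructor
  · calc ∑ i ∈ U, (2 * γ / (L i - (L k - 2 * γ * U.card))) ^ 3
        ≤ ∑ i ∈ U, (U.card : ℝ)⁻¹ := by
          refine Finset.sum_le_sum fun i hi => ?_
          have h0 : 2 * γ / (L i - (L k - 2 * γ * U.card)) ≤ (U.card : ℝ)⁻¹ := by
            rw [div_le_iff₀ (hlt _ ⟨le_rfl, hle⟩ i hi), inv_mul_eq_div, le_div_iff₀ (by linarith)]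
            linarith [hmin i hi]
          have h1 : 0 ≤ 2 * γ / (L i - (L k - 2 * γ * U.card)) :=
            div_nonneg (by linarith) (hlt _ ⟨le_rfl, hle⟩ i hi).le
          exact (pow_le_of_le_one h1 (h0.trans (inv_le_one_of_one_le₀ hc)) (by norm_num)).trans h0
      _ = 1 := by
          rw [Finset.sum_const, nsmul_eq_mul, mul_inv_cancel₀ (by linarith)]
  · have : (2 * γ / (L k - (L k - 2 * γ))) ^ 3 = 1 := by
      rw [sub_sub_cancel, div_self (by linarith), one_pow]
    rw [← this]
    refine Finset.single_le_sum (f := fun i => (2 * γ / (L i - (L k - 2 * γ))) ^ 3)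
      (fun i hi => ?_) hk
    have := hlt (L k - 2 * γ) ⟨hle, le_rfl⟩ i hi
    positivity

open Classical in
/-- The Lagrange multiplier of the `2/3`-Tsallis FTRL problem on the simplex over `U`. -/
def multiplier (U : Finset ι) (γ : ℝ) (L : ι → ℝ) : ℝ :=
  if h : ∃ l, (∀ i ∈ U, l < L i) ∧ ∑ i ∈ U, (2 * γ / (L i - l)) ^ 3 = 1 then h.choose else 0

/-- The cube root of the weight of `i` in the FTRL distribution on the simplex over `U`. -/
def root (U : Finset ι) (γ : ℝ) (L : ι → ℝ) (i : ι) : ℝ := 2 * γ / (L i - multiplier U γ L)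

/-- The optimal value of the FTRL problem on the simplex over `U`. -/
def value (U : Finset ι) (γ : ℝ) (L : ι → ℝ) : ℝ :=
  ∑ i ∈ U, root U γ L i ^ 3 * L i - 3 * γ * ∑ i ∈ U, root U γ L i ^ 2

variable {U : Finset ι} {γ : ℝ} {L : ι → ℝ}

theorem multiplier_lt (hU : U.Nonempty) (hγ : 0 < γ) (L : ι → ℝ) {i : ι} (hi : i ∈ U) :
    multiplier U γ L < L i := by
  have h := exists_multiplier hU hγ L
  rw [multiplier, dif_pos h]
  exact h.choose_spec.1 i hi

theorem sum_root_cube (hU : U.Nonempty) (hγ : 0 < γ) (L : ι → ℝ) :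
    ∑ i ∈ U, root U γ L i ^ 3 = 1 := by
  have h := exists_multiplier hU hγ L
  simp only [root, multiplier, dif_pos h]
  exact h.choose_spec.2

theorem root_pos (hU : U.Nonempty) (hγ : 0 < γ) (L : ι → ℝ) {i : ι} (hi : i ∈ U) :
    0 < root U γ L i :=
  div_pos (by linarith) (by linarith [multiplier_lt hU hγ L hi])

theorem root_le_one (hU : U.Nonempty) (hγ : 0 < γ) (L : ι → ℝ) {i : ι} (hi : i ∈ U) :
    root U γ L i ≤ 1 := by
  have h : root U γ L i ^ 3 ≤ 1 := by
    rw [← sum_root_cube hU hγ L]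
    exact Finset.single_le_sum (f := fun i => root U γ L i ^ 3)
      (fun i hi => (pow_pos (root_pos hU hγ L hi) 3).le) hi
  exact (pow_le_one_iff_of_nonneg (root_pos hU hγ L hi).le (by norm_num)).1 h

theorem le_multiplier (hU : U.Nonempty) (hγ : 0 < γ) {l : ℝ} (hl : ∀ i ∈ U, l < L i)
    (h : ∑ i ∈ U, (2 * γ / (L i - l)) ^ 3 ≤ 1) : l ≤ multiplier U γ L := by
  by_contra! hlt
  refine absurd h (not_le.2 ?_)
  rw [← sum_root_cube hU hγ L]
  refine Finset.sum_lt_sum_of_nonempty hU fun i hi => ?_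
  have := hl i hi
  have := root_pos hU hγ L hi
  refine pow_lt_pow_left₀ ?_ this.le (by norm_num)
  exact div_lt_div_of_pos_left (by linarith) (by linarith) (by linarith)

/-- This makes the multiplier 1-Lipschitz in the sup norm, the source of the continuity and
measurability used below. -/
theorem multiplier_le_add (hU : U.Nonempty) (hγ : 0 < γ) {L' : ι → ℝ} {c : ℝ}
    (h : ∀ i ∈ U, L' i ≤ L i + c) : multiplier U γ L' ≤ multiplier U γ L + c := by
  rw [← sub_le_iff_le_add]
  have hlt := fun i hi => multiplier_lt hU hγ L' (i := i) hi
  refine le_multiplier hU hγ (fun i hi => by linarith [h i hi, hlt i hi]) ?_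
  rw [← sum_root_cube hU hγ L']
  refine Finset.sum_le_sum fun i hi => ?_
  have h1 := h i hi
  have h2 := hlt i hi
  refine pow_le_pow_left₀ (div_nonneg (by linarith) (by linarith)) ?_ 3
  exact div_le_div_of_nonneg_left (by linarith) (by linarith) (by linarith)

theorem multiplier_mono (hU : U.Nonempty) (hγ : 0 < γ) {L' : ι → ℝ}
    (h : ∀ i ∈ U, L' i ≤ L i) : multiplier U γ L' ≤ multiplier U γ L := by
  simpa using multiplier_le_add (c := 0) hU hγ (by simpa using h)

/-- Removing arms loses mass, and the multiplier must rise to restore it. -/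
theorem multiplier_anti_subset {W : Finset ι} (hU : U.Nonempty) (hUW : U ⊆ W) (hγ : 0 < γ)
    (L : ι → ℝ) : multiplier W γ L ≤ multiplier U γ L := by
  have hW := hU.mono hUW
  refine le_multiplier hU hγ (fun i hi => multiplier_lt hW hγ L (hUW hi)) ?_
  rw [← sum_root_cube hW hγ L]
  exact Finset.sum_le_sum_of_subset_of_nonneg hUW fun i hi _ =>
    (pow_pos (root_pos hW hγ L hi) 3).le

theorem root_le_root_subset {W : Finset ι} (hUW : U ⊆ W) (hγ : 0 < γ)
    (L : ι → ℝ) {i : ι} (hi : i ∈ U) : root W γ L i ≤ root U γ L i := by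
  have hU : U.Nonempty := ⟨i, hi⟩
  have := multiplier_anti_subset hU hUW hγ L
  have := multiplier_lt hU hγ L hi
  exact div_le_div_of_nonneg_left (by linarith) (by linarith) (by linarith)

theorem multiplier_anti_rate (hU : U.Nonempty) {γ' : ℝ} (hγ' : 0 < γ') (h : γ' ≤ γ)
    (L : ι → ℝ) : multiplier U γ L ≤ multiplier U γ' L := by
  have hγ : 0 < γ := by linarith
  refine le_multiplier hU hγ' (fun i hi => multiplier_lt hU hγ L hi) ?_
  rw [← sum_root_cube hU hγ L]
  refine Finset.sum_le_sum fun i hi => ?_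
  have := multiplier_lt hU hγ L hi
  refine pow_le_pow_left₀ (div_nonneg (by linarith) (by linarith)) ?_ 3
  exact div_le_div_of_nonneg_right (by linarith) (by linarith)

/-- A larger rate lowers the multiplier and so enlarges the denominator; only the numerator can
raise the root, by the ratio of the rates. -/
theorem root_le_rate_mul_root {γ' : ℝ} (hγ' : 0 < γ') (h : γ' ≤ γ)
    (L : ι → ℝ) {i : ι} (hi : i ∈ U) : root U γ L i ≤ γ / γ' * root U γ' L i := by
  have hU : U.Nonempty := ⟨i, hi⟩
  have h1 := multiplier_anti_rate hU hγ' h L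
  have h2 := multiplier_lt hU hγ' L hi
  have : γ / γ' * root U γ' L i = 2 * γ / (L i - multiplier U γ' L) := by
    rw [root]; field_simp
  rw [this]
  exact div_le_div_of_nonneg_left (by linarith) (by linarith) (by linarith)

theorem continuous_multiplier [Finite ι] (hU : U.Nonempty) (hγ : 0 < γ) :
    Continuous (multiplier U γ : (ι → ℝ) → ℝ) := by
  have := Fintype.ofFinite ι
  refine (LipschitzWith.of_le_add fun L L' => ?_).continuous
  refine multiplier_le_add hU hγ fun i _ => ?_
  have := (abs_le.1 ((Real.dist_eq _ _).symm.trans_le (dist_le_pi_dist L L' i))).2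
  linarith

theorem continuous_root [Finite ι] (hγ : 0 < γ) {i : ι} (hi : i ∈ U) :
    Continuous (fun L : ι → ℝ => root U γ L i) := by
  have hU : U.Nonempty := ⟨i, hi⟩
  refine continuous_const.div ((continuous_apply i).sub (continuous_multiplier hU hγ)) fun L => ?_
  linarith [multiplier_lt hU hγ L hi]

theorem loss_sub_multiplier (hγ : 0 < γ) (L : ι → ℝ) {i : ι} (hi : i ∈ U) :
    L i - multiplier U γ L = 2 * γ / root U γ L i := by
  have := multiplier_lt ⟨i, hi⟩ hγ L hi
  rw [root, div_div_cancel₀ (by linarith)]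

/-- The tangent line inequality for `x ↦ x ^ (2/3)` at `u ^ 3`, at the point `w ^ 3`. -/
theorem sq_le_tangent {u w : ℝ} (hu : 0 < u) (hw : 0 ≤ w) :
    w ^ 2 ≤ u ^ 2 + 2 / (3 * u) * (w ^ 3 - u ^ 3) := by
  have : u ^ 2 + 2 / (3 * u) * (w ^ 3 - u ^ 3) - w ^ 2 = (w - u) ^ 2 * (2 * w + u) / (3 * u) := by
    field_simp; ring
  have : 0 ≤ (w - u) ^ 2 * (2 * w + u) / (3 * u) := by positivity
  linarith

theorem eq_of_tangent_le {u w : ℝ} (hu : 0 < u) (hw : 0 ≤ w)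
    (h : u ^ 2 + 2 / (3 * u) * (w ^ 3 - u ^ 3) ≤ w ^ 2) : w = u := by
  have h1 : u ^ 2 + 2 / (3 * u) * (w ^ 3 - u ^ 3) - w ^ 2 =
      (w - u) ^ 2 * (2 * w + u) / (3 * u) := by
    field_simp; ring
  have h2 : (w - u) ^ 2 * (2 * w + u) / (3 * u) ≤ 0 := by linarith
  have h3 : (w - u) ^ 2 ≤ 0 := by
    by_contra! h4
    have : 0 < (w - u) ^ 2 * (2 * w + u) / (3 * u) := by positivity
    linarith
  have := pow_eq_zero_iff (two_ne_zero) |>.1 (le_antisymm h3 (sq_nonneg _))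
  linarith

/-- The excess of the objective over its optimum is a Bregman divergence: the multiplier cancels
because both distributions have mass one. -/
theorem value_add_gap (hγ : 0 < γ) (L : ι → ℝ) (w : ι → ℝ) (hU : U.Nonempty)
    (hsum : ∑ i ∈ U, w i ^ 3 = 1) :
    (∑ i ∈ U, w i ^ 3 * L i - 3 * γ * ∑ i ∈ U, w i ^ 2) - value U γ L =
      3 * γ * ∑ i ∈ U, (root U γ L i ^ 2 + 2 / (3 * root U γ L i) *
        (w i ^ 3 - root U γ L i ^ 3) - w i ^ 2) := by
  have h1 : ∑ i ∈ U, (w i ^ 3 - root U γ L i ^ 3) * multiplier U γ L = 0 := by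
    rw [← Finset.sum_mul, Finset.sum_sub_distrib, hsum, sum_root_cube hU hγ L, sub_self, zero_mul]
  have h2 : ∑ i ∈ U, (w i ^ 3 - root U γ L i ^ 3) * L i =
      ∑ i ∈ U, (w i ^ 3 - root U γ L i ^ 3) * (2 * γ / root U γ L i) := by
    rw [← sub_zero (∑ i ∈ U, (w i ^ 3 - root U γ L i ^ 3) * L i), ← h1, ← Finset.sum_sub_distrib]
    refine Finset.sum_congr rfl fun i hi => ?_
    rw [← loss_sub_multiplier hγ L hi]
    ring
  have h3 : ∑ i ∈ U, (w i ^ 3 - root U γ L i ^ 3) * L i =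
      ∑ i ∈ U, w i ^ 3 * L i - ∑ i ∈ U, root U γ L i ^ 3 * L i := by
    rw [← Finset.sum_sub_distrib]
    exact Finset.sum_congr rfl fun i _ => by ring
  have h4 : 3 * γ * ∑ i ∈ U, (root U γ L i ^ 2 + 2 / (3 * root U γ L i) *
        (w i ^ 3 - root U γ L i ^ 3) - w i ^ 2) =
      3 * γ * ∑ i ∈ U, root U γ L i ^ 2 +
        ∑ i ∈ U, (w i ^ 3 - root U γ L i ^ 3) * (2 * γ / root U γ L i) -
        3 * γ * ∑ i ∈ U, w i ^ 2 := by
    rw [Finset.mul_sum, Finset.mul_sum, Finset.mul_sum, ← Finset.sum_add_distrib,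
      ← Finset.sum_sub_distrib]
    refine Finset.sum_congr rfl fun i hi => ?_
    have := (root_pos hU hγ L hi).ne'
    field_simp
  rw [h4, ← h2, h3, value]
  ring

theorem value_le (hγ : 0 < γ) (L : ι → ℝ) {w : ι → ℝ} (hU : U.Nonempty)
    (hw : ∀ i ∈ U, 0 ≤ w i) (hsum : ∑ i ∈ U, w i ^ 3 = 1) :
    value U γ L ≤ ∑ i ∈ U, w i ^ 3 * L i - 3 * γ * ∑ i ∈ U, w i ^ 2 := by
  have h := value_add_gap hγ L w hU hsum
  have : 0 ≤ ∑ i ∈ U, (root U γ L i ^ 2 + 2 / (3 * root U γ L i) *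
        (w i ^ 3 - root U γ L i ^ 3) - w i ^ 2) :=
    Finset.sum_nonneg fun i hi => by linarith [sq_le_tangent (root_pos hU hγ L hi) (hw i hi)]
  have : 0 ≤ 3 * γ * ∑ i ∈ U, (root U γ L i ^ 2 + 2 / (3 * root U γ L i) *
        (w i ^ 3 - root U γ L i ^ 3) - w i ^ 2) := by positivity
  linarith

/-- Uniqueness of the minimizer: every term of the Bregman divergence must vanish. This identifies
the chosen minimizer `ftrl`. -/
theorem eq_root_of_le_value (hγ : 0 < γ) (L : ι → ℝ) {w : ι → ℝ} (hU : U.Nonempty)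
    (hw : ∀ i ∈ U, 0 ≤ w i) (hsum : ∑ i ∈ U, w i ^ 3 = 1)
    (hle : ∑ i ∈ U, w i ^ 3 * L i - 3 * γ * ∑ i ∈ U, w i ^ 2 ≤ value U γ L) {i : ι} (hi : i ∈ U) :
    w i = root U γ L i := by
  have h := value_add_gap hγ L w hU hsum
  have hnn : ∀ i ∈ U, 0 ≤ root U γ L i ^ 2 + 2 / (3 * root U γ L i) *
        (w i ^ 3 - root U γ L i ^ 3) - w i ^ 2 :=
    fun i hi => by linarith [sq_le_tangent (root_pos hU hγ L hi) (hw i hi)]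
  have h0 : ∑ i ∈ U, (root U γ L i ^ 2 + 2 / (3 * root U γ L i) *
        (w i ^ 3 - root U γ L i ^ 3) - w i ^ 2) ≤ 0 := by
    by_contra! hpos
    have : 0 < 3 * γ * ∑ i ∈ U, (root U γ L i ^ 2 + 2 / (3 * root U γ L i) *
        (w i ^ 3 - root U γ L i ^ 3) - w i ^ 2) := by positivity
    linarith
  have h1 := (Finset.sum_eq_zero_iff_of_nonneg hnn).1 (le_antisymm h0 (Finset.sum_nonneg hnn)) i hi
  exact eq_of_tangent_le (root_pos hU hγ L hi) (hw i hi) (by linarith)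

/-- The weights of the FTRL distribution form a supergradient of its value. -/
theorem value_le_add (hγ : 0 < γ) (L L' : ι → ℝ) (hU : U.Nonempty) :
    value U γ L' ≤ value U γ L + ∑ i ∈ U, root U γ L i ^ 3 * (L' i - L i) := by
  have h := value_le hγ L' hU (fun i hi => (root_pos hU hγ L hi).le) (sum_root_cube hU hγ L)
  simp only [mul_sub, Finset.sum_sub_distrib]
  nth_rewrite 2 [value]
  linarith

/-- The optimizer for `γ` competes in the problem for `γ'`. The rates are not ordered, so that the
bound serves in both directions. -/
theorem value_mono_rate {γ' : ℝ} (hγ : 0 < γ) (hγ' : 0 < γ') (L : ι → ℝ) (hU : U.Nonempty) :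
    value U γ' L ≤ value U γ L + 3 * (γ - γ') * ∑ i ∈ U, root U γ L i ^ 2 := by
  have h := value_le hγ' L hU (fun i hi => (root_pos hU hγ L hi).le) (sum_root_cube hU hγ L)
  nth_rewrite 2 [value]
  linarith

/-- The optimizer of the smaller face, extended by zero, is feasible on the larger one. -/
theorem value_anti_subset {W : Finset ι} (hU : U.Nonempty) (hUW : U ⊆ W) (hγ : 0 < γ)
    (L : ι → ℝ) : value W γ L ≤ value U γ L := by
  classical
  have hz : ∀ n : ℕ, n ≠ 0 → ∀ g : ι → ℝ, ∑ i ∈ W, (if i ∈ U then root U γ L i else 0) ^ n * g i =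
      ∑ i ∈ U, root U γ L i ^ n * g i := by
    intro n hn g
    rw [← Finset.sum_subset hUW]
    · exact Finset.sum_congr rfl fun i hi => by rw [if_pos hi]
    · intro i _ hi
      rw [if_neg hi, zero_pow hn, zero_mul]
  have h := value_le (U := W) (w := fun i => if i ∈ U then root U γ L i else 0) hγ L (hU.mono hUW)
    (fun i _ => by
      split_ifs with hi
      · exact (root_pos hU hγ L hi).le
      · exact le_rfl)
    (by simpa using (hz 3 (by norm_num) 1).trans (by simpa using sum_root_cube hU hγ L))
  have h2 := hz 2 (by norm_num) 1
  simp only [Pi.one_apply, mul_one] at h2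
  rw [hz 3 (by norm_num), h2] at h
  exact h

end Multiplier

/-! ### The algorithm's distributions in terms of the roots. -/

section FTRL

variable {K : ℕ} [NeZero K]

theorem rate_pos (t : ℕ) : 0 < rate K t := by
  have : (0 : ℝ) < K := by exact_mod_cast Nat.pos_of_ne_zero (NeZero.ne K)
  unfold rate
  positivity

theorem cube_rpow_two_thirds {u : ℝ} (hu : 0 ≤ u) : (u ^ 3) ^ (2 / 3 : ℝ) = u ^ 2 := by
  rw [← Real.rpow_natCast u 3, ← Real.rpow_mul hu, ← Real.rpow_natCast u 2]
  norm_num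

theorem ftrl_eq (t : ℕ) (L : Fin K → ℝ) (i : Fin K) :
    ftrl t L i = root Finset.univ (rate K t) L i ^ 3 := by
  have hγ := rate_pos (K := K) t
  have hU : (Finset.univ : Finset (Fin K)).Nonempty := Finset.univ_nonempty
  obtain ⟨hmem, hmin⟩ := (exists_objective_min t L).choose_spec
  change ftrl t L ∈ _ at hmem
  have hobj : ∀ w : Fin K → ℝ, (∀ i, 0 ≤ w i) → objective t L (fun i => w i ^ 3) =
      ∑ i, w i ^ 3 * L i - 3 * rate K t * ∑ i, w i ^ 2 := by
    intro w hw
    simp only [objective, tsallis, cube_rpow_two_thirds (hw _), ← Finset.mul_sum]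
    ring
  have hcube : (fun i => (ftrl t L i ^ (1 / 3 : ℝ)) ^ 3) = ftrl t L := by
    funext i
    rw [← Real.rpow_natCast, ← Real.rpow_mul (hmem.1 i)]
    norm_num
  have hw : ∀ i, 0 ≤ ftrl t L i ^ (1 / 3 : ℝ) := fun i => Real.rpow_nonneg (hmem.1 i) _
  have hr : ∀ i, 0 ≤ root Finset.univ (rate K t) L i :=
    fun i => (root_pos hU hγ L (Finset.mem_univ i)).le
  have h := hmin (show (fun i => root Finset.univ (rate K t) L i ^ 3) ∈ stdSimplex ℝ (Fin K) from
    ⟨fun i => pow_nonneg (hr i) 3, sum_root_cube hU hγ L⟩)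
  change objective t L (ftrl t L) ≤ objective t L _ at h
  rw [hobj _ hr, ← hcube, hobj _ hw] at h
  have hsum : ∑ i, (ftrl t L i ^ (1 / 3 : ℝ)) ^ 3 = 1 := by
    exact (Finset.sum_congr rfl fun i _ => congr_fun hcube i).trans hmem.2
  rw [← eq_root_of_le_value hγ L hU (fun i _ => hw i) hsum h (Finset.mem_univ i)]
  exact (congr_fun hcube i).symm

theorem explore_ftrl (t : ℕ) (L : Fin K → ℝ) (i : Fin K) :
    explore (ftrl t L) i = root Finset.univ (rate K t) L i ^ 2 /
      ∑ k, root Finset.univ (rate K t) L k ^ 2 := by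
  have h : ∀ k, ftrl t L k ^ (2 / 3 : ℝ) = root Finset.univ (rate K t) L k ^ 2 := fun k => by
    rw [ftrl_eq, cube_rpow_two_thirds (root_pos Finset.univ_nonempty (rate_pos t) L
      (Finset.mem_univ k)).le]
  simp only [explore, h]

end FTRL

/-! ### Stability terms and their comparison between two faces. -/

section Stability

/-- The supergradient inequalities at `y` and at `z` sandwich the linearization error between `0`
and `(p z - p y) * (z - y)`. -/
theorem hasDerivAt_of_supergradient {f p : ℝ → ℝ} (hp : Continuous p)
    (h : ∀ y z, f z ≤ f y + p y * (z - y)) (y : ℝ) : HasDerivAt f (p y) y := by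
  rw [hasDerivAt_iff_isLittleO]
  refine Asymptotics.IsLittleO.of_bound fun c hc => ?_
  have hev : ∀ᶠ z in nhds y, dist (p z) (p y) < c :=
    hp.continuousAt.eventually (Metric.ball_mem_nhds _ hc)
  filter_upwards [hev] with z hz
  rw [Real.dist_eq] at hz
  have h1 := h y z
  have h2 := h z y
  have h3 : |(p z - p y) * (z - y)| ≤ c * |z - y| := by
    rw [abs_mul]
    exact mul_le_mul_of_nonneg_right hz.le (abs_nonneg _)
  have h4 := neg_abs_le ((p z - p y) * (z - y))
  rw [Real.norm_eq_abs, Real.norm_eq_abs, smul_eq_mul, abs_le]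
  constructor <;> nlinarith [mul_nonneg hc.le (abs_nonneg (z - y))]

/-- The tangent line inequality for the convex function `s ↦ (g / s) ^ 3`. -/
theorem tangent_le_div_cube {g s s' : ℝ} (hg : 0 < g) (hs : 0 < s) (hs' : 0 < s') :
    (g / s) ^ 3 - 3 / g * (g / s) ^ 4 * (s' - s) ≤ (g / s') ^ 3 := by
  have : (g / s') ^ 3 - ((g / s) ^ 3 - 3 / g * (g / s) ^ 4 * (s' - s)) =
      g ^ 3 * (s - s') ^ 2 * (s ^ 2 + 2 * s * s' + 3 * s' ^ 2) / (s ^ 4 * s' ^ 3) := by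
    field_simp; ring
  have : 0 ≤ g ^ 3 * (s - s') ^ 2 * (s ^ 2 + 2 * s * s' + 3 * s' ^ 2) / (s ^ 4 * s' ^ 3) := by
    positivity
  linarith

theorem div_cube_sub_anti {g a b h : ℝ} (hg : 0 < g) (ha : 0 < a) (hab : a ≤ b) (hh : 0 ≤ h) :
    (g / b) ^ 3 - (g / (b + h)) ^ 3 ≤ (g / a) ^ 3 - (g / (a + h)) ^ 3 := by
  have hb : 0 < b := by linarith
  have key : ∀ s, 0 < s → (g / s) ^ 3 - (g / (s + h)) ^ 3 = g * h / (s * (s + h)) *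
      ((g / s) ^ 2 + (g / s) * (g / (s + h)) + (g / (s + h)) ^ 2) := by
    intro s hs
    have : 0 < s + h := by linarith
    field_simp
    ring
  rw [key a ha, key b hb]
  have : 0 < a + h := by linarith
  gcongr

theorem div_cube_anti {g a b : ℝ} (hg : 0 < g) (ha : 0 < a) (hab : a ≤ b) :
    (g / b) ^ 3 ≤ (g / a) ^ 3 := by
  have hb : 0 < b := by linarith
  gcongr

variable {ι : Type*} [DecidableEq ι]

/-- The Bregman-type stability term of an FTRL step in which the loss of arm `j` grows by `x`. -/
def stability (U : Finset ι) (γ : ℝ) (L : ι → ℝ) (j : ι) (x : ℝ) : ℝ :=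
  (if j ∈ U then root U γ L j ^ 3 else 0) * x + value U γ L - value U γ (L + Pi.single j x)

variable {U : Finset ι} {γ : ℝ} {L : ι → ℝ} {j : ι} {x y : ℝ}

theorem sum_mul_single (w : ι → ℝ) :
    ∑ i ∈ U, w i * (Pi.single j x : ι → ℝ) i = (if j ∈ U then w j else 0) * x := by
  simp [Pi.single_apply]

theorem stability_nonneg (hU : U.Nonempty) (hγ : 0 < γ) (L : ι → ℝ) (j : ι) (x : ℝ) :
    0 ≤ stability U γ L j x := by
  have h := value_le_add hγ L (L + Pi.single j x) hU
  simp only [Pi.add_apply, add_sub_cancel_left, sum_mul_single (fun i => root U γ L i ^ 3)] at h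
  rw [stability]
  linarith

theorem multiplier_le_add_single (hU : U.Nonempty) (hγ : 0 < γ) (L : ι → ℝ) (j : ι) (hx : 0 ≤ x) :
    multiplier U γ L ≤ multiplier U γ (L + Pi.single j x) := by
  refine multiplier_mono hU hγ fun i _ => ?_
  rw [Pi.add_apply, Pi.single_apply]
  split_ifs <;> linarith

theorem multiplier_add_single_le (hU : U.Nonempty) (hγ : 0 < γ) (L : ι → ℝ) (j : ι) (hx : 0 ≤ x) :
    multiplier U γ (L + Pi.single j x) ≤ multiplier U γ L + x := by
  refine multiplier_le_add hU hγ fun i _ => ?_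
  rw [Pi.add_apply, Pi.single_apply]
  split_ifs <;> linarith

/-- The multiplier does not fall, so the denominator of arm `j` grows by at most `x`; convexity does
the rest. -/
theorem root_cube_sub_le (hγ : 0 < γ) (L : ι → ℝ) (hj : j ∈ U) (hx : 0 ≤ x) :
    root U γ L j ^ 3 - root U γ (L + Pi.single j x) j ^ 3 ≤
      3 / (2 * γ) * root U γ L j ^ 4 * x := by
  have hU : U.Nonempty := ⟨j, hj⟩
  have h1 := multiplier_le_add_single hU hγ L j hx
  have h2 := multiplier_lt hU hγ L hj
  have h3 := multiplier_lt hU hγ (L + Pi.single j x) hj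
  have h4 := tangent_le_div_cube (g := 2 * γ) (s := L j - multiplier U γ L)
    (s' := (L + Pi.single j x : ι → ℝ) j - multiplier U γ (L + Pi.single j x))
    (by linarith) (by linarith) (by linarith)
  rw [Pi.add_apply, Pi.single_eq_same] at h4
  have h5 : root U γ L j ^ 3 - root U γ (L + Pi.single j x) j ^ 3 ≤ 3 / (2 * γ) *
      root U γ L j ^ 4 * (L j + x - multiplier U γ (L + Pi.single j x) -
        (L j - multiplier U γ L)) := by
    unfold root
    rw [Pi.add_apply, Pi.single_eq_same]
    linarith
  have := root_pos hU hγ L hj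
  refine h5.trans (mul_le_mul_of_nonneg_left (by linarith) (by positivity))

/-- The supergradient inequality at the shifted losses bounds the stability by `x` times the drop of
the weight of `j`. -/
theorem stability_le (hγ : 0 < γ) (L : ι → ℝ) (hj : j ∈ U) (hx : 0 ≤ x) :
    stability U γ L j x ≤ 3 / (2 * γ) * root U γ L j ^ 4 * x ^ 2 := by
  have h := value_le_add hγ (L + Pi.single j x) L ⟨j, hj⟩
  simp only [Pi.add_apply, sub_add_cancel_left, mul_neg, Finset.sum_neg_distrib,
    sum_mul_single (fun i => root U γ (L + Pi.single j x) i ^ 3), if_pos hj] at h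
  have h2 := mul_le_mul_of_nonneg_right (root_cube_sub_le hγ L hj hx) hx
  rw [stability, if_pos hj]
  linarith

/-- Increasing the loss of arm `j` by `x` moves the multiplier by at most the fraction
`u j ^ 4 / ∑ u i ^ 4` of `x`. -/
theorem multiplier_shift_mul_le (hγ : 0 < γ) (L : ι → ℝ) (hj : j ∈ U) (x : ℝ) :
    (multiplier U γ (L + Pi.single j x) - multiplier U γ L) * ∑ i ∈ U, root U γ L i ^ 4 ≤
      root U γ L j ^ 4 * x := by
  have hU : U.Nonempty := ⟨j, hj⟩
  set σ := multiplier U γ (L + Pi.single j x) - multiplier U γ L with hσ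
  have h : ∀ i ∈ U, root U γ L i ^ 3 - 3 / (2 * γ) *
      (root U γ L i ^ 4 * (Pi.single j x : ι → ℝ) i - σ * root U γ L i ^ 4) ≤
      root U γ (L + Pi.single j x) i ^ 3 := by
    intro i hi
    have h1 := multiplier_lt hU hγ L hi
    have h2 := multiplier_lt hU hγ (L + Pi.single j x) hi
    have h4 := tangent_le_div_cube (g := 2 * γ) (s := L i - multiplier U γ L)
      (s' := (L + Pi.single j x : ι → ℝ) i - multiplier U γ (L + Pi.single j x))
      (by linarith) (by linarith) (by linarith)
    refine le_trans (le_of_eq ?_) h4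
    rw [hσ, Pi.add_apply, root]
    ring
  have h2 := Finset.sum_le_sum h
  rw [Finset.sum_sub_distrib, sum_root_cube hU hγ, sum_root_cube hU hγ, ← Finset.mul_sum,
    Finset.sum_sub_distrib, sum_mul_single (fun i => root U γ L i ^ 4), if_pos hj,
    ← Finset.mul_sum] at h2
  by_contra! h3
  have : 0 < 3 / (2 * γ) * (σ * ∑ i ∈ U, root U γ L i ^ 4 - root U γ L j ^ 4 * x) :=
    mul_pos (by positivity) (by linarith)
  linarith

/-- By this derivative, the stability is the integral over `[0, x]` of the drop of the weight of
`j`. -/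
theorem hasDerivAt_value [Finite ι] (hγ : 0 < γ) (L : ι → ℝ) (hj : j ∈ U) (y : ℝ) :
    HasDerivAt (fun y => value U γ (L + Pi.single j y)) (root U γ (L + Pi.single j y) j ^ 3) y := by
  refine hasDerivAt_of_supergradient (p := fun y => root U γ (L + Pi.single j y) j ^ 3) ?_ ?_ y
  · have h : Continuous fun y : ℝ => L + (Pi.single j y : ι → ℝ) := by
      refine continuous_const.add (continuous_pi fun i => ?_)
      simp only [Pi.single_apply]
      split_ifs <;> fun_prop
    exact ((continuous_root hγ hj).comp h).pow 3
  · intro y z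
    have h := value_le_add hγ (L + Pi.single j y) (L + Pi.single j z) ⟨j, hj⟩
    have : ∀ i, (L + Pi.single j z : ι → ℝ) i - (L + Pi.single j y : ι → ℝ) i =
        (Pi.single j (z - y) : ι → ℝ) i := by
      intro i
      simp only [Pi.add_apply, Pi.single_apply]
      split_ifs <;> ring
    simp only [this, sum_mul_single (fun i => root U γ (L + Pi.single j y) i ^ 3), if_pos hj] at h
    exact h

/-- When the loss of an arm `j ∈ U` grows, its weight on the simplex over a larger set `W` falls
hardly faster than its weight on the simplex over `U`. -/
theorem weight_drop_sub_mul_le {W : Finset ι} (hUW : U ⊆ W) (hγ : 0 < γ) (L : ι → ℝ) (hj : j ∈ U)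
    (hy : 0 ≤ y) (hσ : multiplier W γ (L + Pi.single j y) - multiplier W γ L ≤ γ) :
    ((root W γ L j ^ 3 - root W γ (L + Pi.single j y) j ^ 3) -
      (root U γ L j ^ 3 - root U γ (L + Pi.single j y) j ^ 3)) * ∑ i ∈ U, root W γ L i ^ 4 ≤
    24 / γ * (multiplier W γ (L + Pi.single j y) - multiplier W γ L) *
      (∑ i ∈ W \ U, root W γ L i ^ 4) * root W γ L j ^ 4 := by
  have hU : U.Nonempty := ⟨j, hj⟩
  have hW := hU.mono hUW
  set L' := L + Pi.single j y with hL'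
  have hL'j : L' j = L j + y := by simp [hL']
  have hL'i : ∀ i, i ≠ j → L' i = L i := fun i hi => by simp [hL', hi]
  set l := multiplier W γ L with hl
  set m := multiplier U γ L with hm
  set σ := multiplier W γ L' - l with hσd
  set τ := multiplier U γ L' - m with hτd
  have hσ0 : 0 ≤ σ := sub_nonneg.2 (multiplier_le_add_single hW hγ L j hy)
  have hτ0 : 0 ≤ τ := sub_nonneg.2 (multiplier_le_add_single hU hγ L j hy)
  have hσy : σ ≤ y := by linarith [multiplier_add_single_le hW hγ L j hy]
  have hτy : τ ≤ y := by linarith [multiplier_add_single_le hU hγ L j hy]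
  have hlm : l ≤ m := multiplier_anti_subset hU hUW hγ L
  have hg : 0 < 2 * γ := by linarith
  have hup : ∀ i ∈ W, 0 < root W γ L i := fun i hi => root_pos hW hγ L hi
  have hα : ∀ i ∈ W, 0 < L i - l := fun i hi => sub_pos.2 (multiplier_lt hW hγ L hi)
  have hα' : ∀ i ∈ W, i ≠ j → 0 < L i - l - σ := fun i hi hij => by
    have := multiplier_lt hW hγ L' hi
    rw [hL'i i hij] at this
    linarith
  have hβ : ∀ i ∈ U, 0 < L i - m := fun i hi => sub_pos.2 (multiplier_lt hU hγ L hi)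
  have hβ' : ∀ i ∈ U, i ≠ j → 0 < L i - m - τ := fun i hi hij => by
    have := multiplier_lt hU hγ L' hi
    rw [hL'i i hij] at this
    linarith
  have hu : ∀ i, root W γ L i = 2 * γ / (L i - l) := fun i => rfl
  have hv : ∀ i, root U γ L i = 2 * γ / (L i - m) := fun i => rfl
  have huj : root W γ L' j = 2 * γ / (L j - l + (y - σ)) := by
    rw [root, hL'j]; congr 1; ring
  have hvj : root U γ L' j = 2 * γ / (L j - m + (y - τ)) := by
    rw [root, hL'j]; congr 1; ring
  have hui : ∀ i, i ≠ j → root W γ L' i = 2 * γ / (L i - l - σ) := fun i hi => by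
    rw [root, hL'i i hi]; congr 1; ring
  have hvi : ∀ i, i ≠ j → root U γ L' i = 2 * γ / (L i - m - τ) := fun i hi => by
    rw [root, hL'i i hi]; congr 1; ring
  set d := (root W γ L j ^ 3 - root W γ L' j ^ 3) - (root U γ L j ^ 3 - root U γ L' j ^ 3) with hd
  have hAU : 0 ≤ ∑ i ∈ U, root W γ L i ^ 4 :=
    Finset.sum_nonneg fun i hi => pow_nonneg (hup i (hUW hi)).le 4
  have hB : 0 ≤ ∑ i ∈ W \ U, root W γ L i ^ 4 :=
    Finset.sum_nonneg fun i hi => pow_nonneg (hup i (Finset.sdiff_subset hi)).le 4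
  have hjW := hUW hj
  have huj0 := hup j hjW
  -- If the multiplier moves less on `U` than on `W`, the weight on `U` drops at least as much by
  -- convexity. Otherwise `d` is bounded twice, from the formula for arm `j` and from mass
  -- conservation, and `τ - σ` is eliminated.
  rcases lt_or_ge τ σ with hτσ | hστ
  · have h1 := div_cube_sub_anti hg (hβ j hj) (show L j - m ≤ L j - l by linarith)
      (show 0 ≤ y - σ by linarith)
    have h2 := div_cube_anti hg (show 0 < L j - m + (y - σ) by linarith [hβ j hj])
      (show L j - m + (y - σ) ≤ L j - m + (y - τ) by linarith)
    have h3 : d ≤ 0 := by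
      rw [hd, hu j, hv j, huj, hvj]
      linarith
    refine (mul_nonpos_of_nonpos_of_nonneg h3 hAU).trans ?_
    positivity
  · have hd1 : d ≤ 3 / (2 * γ) * root W γ L j ^ 4 * (τ - σ) := by
      have h1 := div_cube_sub_anti hg (hβ j hj) (show L j - m ≤ L j - l by linarith)
        (show 0 ≤ y - τ by linarith)
      have h2 := tangent_le_div_cube hg (show 0 < L j - l + (y - τ) by linarith [hα j hjW])
        (show 0 < L j - l + (y - σ) by linarith [hα j hjW])
      have h3 : (2 * γ / (L j - l + (y - τ))) ^ 4 ≤ (2 * γ / (L j - l)) ^ 4 := by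
        have := hα j hjW
        refine pow_le_pow_left₀ (div_nonneg hg.le (by linarith)) ?_ 4
        exact div_le_div_of_nonneg_left hg.le this (by linarith)
      have h4 : 3 / (2 * γ) * (2 * γ / (L j - l + (y - τ))) ^ 4 * (τ - σ) ≤
          3 / (2 * γ) * (2 * γ / (L j - l)) ^ 4 * (τ - σ) :=
        mul_le_mul_of_nonneg_right (mul_le_mul_of_nonneg_left h3 (by positivity)) (by linarith)
      have h5 : L j - l + (y - σ) - (L j - l + (y - τ)) = τ - σ := by ring
      rw [h5] at h2
      rw [hd, hu j, hv j, huj, hvj]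
      linarith
    have hd2 : d ≤ 24 / γ * σ * ∑ i ∈ W \ U, root W γ L i ^ 4 -
        3 / (2 * γ) * (τ - σ) * ∑ i ∈ U.erase j, root W γ L i ^ 4 := by
      -- What arm `j` loses, the other arms of the face gain.
      have hp : root W γ L j ^ 3 - root W γ L' j ^ 3 =
          ∑ i ∈ W \ U, (root W γ L' i ^ 3 - root W γ L i ^ 3) +
            ∑ i ∈ U.erase j, (root W γ L' i ^ 3 - root W γ L i ^ 3) := by
        have h1 : ∑ i ∈ W, (root W γ L' i ^ 3 - root W γ L i ^ 3) = 0 := by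
          rw [Finset.sum_sub_distrib, sum_root_cube hW hγ, sum_root_cube hW hγ, sub_self]
        rw [← Finset.sum_sdiff hUW, ← Finset.add_sum_erase U _ hj] at h1
        linarith
      have hq : root U γ L j ^ 3 - root U γ L' j ^ 3 =
          ∑ i ∈ U.erase j, (root U γ L' i ^ 3 - root U γ L i ^ 3) := by
        have h1 : ∑ i ∈ U, (root U γ L' i ^ 3 - root U γ L i ^ 3) = 0 := by
          rw [Finset.sum_sub_distrib, sum_root_cube hU hγ, sum_root_cube hU hγ, sub_self]
        rw [← Finset.add_sum_erase U _ hj] at h1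
        linarith
      have hV : ∑ i ∈ W \ U, (root W γ L' i ^ 3 - root W γ L i ^ 3) ≤
          24 / γ * σ * ∑ i ∈ W \ U, root W γ L i ^ 4 := by
        rw [Finset.mul_sum]
        refine Finset.sum_le_sum fun i hi => ?_
        obtain ⟨hiW, hiU⟩ := Finset.mem_sdiff.1 hi
        have hij : i ≠ j := fun h => hiU (h ▸ hj)
        have ha := hα i hiW
        have ha' := hα' i hiW hij
        have h1 : 2 * γ ≤ L i - l := by
          have := root_le_one hW hγ L hiW
          rwa [hu, div_le_one ha] at this
        have h2 := tangent_le_div_cube hg ha' ha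
        -- Since `σ ≤ γ` is at most half of `L i - l`, the root at most doubles. Its fourth power
        -- gives the factor `16`, and `24 = 16 * 3 / 2`.
        have h3 : 2 * γ / (L i - l - σ) ≤ 2 * (2 * γ / (L i - l)) := by
          rw [← mul_div_assoc, div_le_div_iff₀ ha' ha]
          nlinarith
        have h4 : (2 * γ / (L i - l - σ)) ^ 4 ≤ 16 * (2 * γ / (L i - l)) ^ 4 := by
          refine (pow_le_pow_left₀ (by positivity) h3 4).trans (le_of_eq ?_)
          ring
        rw [hui i hij, hu i]
        have h5 : 3 / (2 * γ) * (2 * γ / (L i - l - σ)) ^ 4 * σ ≤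
            3 / (2 * γ) * (16 * (2 * γ / (L i - l)) ^ 4) * σ :=
          mul_le_mul_of_nonneg_right (mul_le_mul_of_nonneg_left h4 (by positivity)) hσ0
        have h6 : 3 / (2 * γ) * (16 * (2 * γ / (L i - l)) ^ 4) * σ =
            24 / γ * σ * (2 * γ / (L i - l)) ^ 4 := by
          field_simp; ring
        rw [sub_sub_cancel] at h2
        linarith
      have hE : ∑ i ∈ U.erase j, (root W γ L' i ^ 3 - root W γ L i ^ 3) -
          ∑ i ∈ U.erase j, (root U γ L' i ^ 3 - root U γ L i ^ 3) ≤
          - (3 / (2 * γ) * (τ - σ) * ∑ i ∈ U.erase j, root W γ L i ^ 4) := by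
        rw [← Finset.sum_sub_distrib, Finset.mul_sum, ← Finset.sum_neg_distrib]
        refine Finset.sum_le_sum fun i hi => ?_
        obtain ⟨hij, hiU⟩ := Finset.mem_erase.1 hi
        have hiW := hUW hiU
        have ha := hα i hiW
        have ha' := hα' i hiW hij
        have hb' := hβ' i hiU hij
        have h1 := div_cube_sub_anti hg hb' (show L i - m - τ ≤ L i - l - τ by linarith) hτ0
        have h2 := tangent_le_div_cube hg ha' (show 0 < L i - l - τ by linarith)
        have h3 : (2 * γ / (L i - l)) ^ 4 ≤ (2 * γ / (L i - l - σ)) ^ 4 := by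
          refine pow_le_pow_left₀ (by positivity) ?_ 4
          exact div_le_div_of_nonneg_left hg.le ha' (by linarith)
        have h4 : 3 / (2 * γ) * (2 * γ / (L i - l)) ^ 4 * (τ - σ) ≤
            3 / (2 * γ) * (2 * γ / (L i - l - σ)) ^ 4 * (τ - σ) :=
          mul_le_mul_of_nonneg_right (mul_le_mul_of_nonneg_left h3 (by positivity)) (by linarith)
        have h5 : L i - l - τ - (L i - l - σ) = -(τ - σ) := by ring
        rw [h5] at h2
        rw [sub_add_cancel, sub_add_cancel] at h1
        rw [hui i hij, hu i, hvi i hij, hv i]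
        linarith
      rw [hd, hp, hq]
      linarith
    have hA : 0 ≤ ∑ i ∈ U.erase j, root W γ L i ^ 4 :=
      Finset.sum_nonneg fun i hi => pow_nonneg (hup i (hUW (Finset.mem_of_mem_erase hi))).le 4
    rw [← Finset.add_sum_erase U _ hj, mul_add]
    -- In `hd1 * ∑_{U \ j} u⁴ + hd2 * uⱼ⁴` the terms with `τ - σ` cancel.
    have h1 := mul_le_mul_of_nonneg_right hd1 hA
    have h2 := mul_le_mul_of_nonneg_right hd2 (pow_nonneg huj0.le 4)
    linarith

/-- The stability on the simplex over `W` is hardly larger than the one on the simplex over `U`. -/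
theorem stability_sub_le [Finite ι] {W : Finset ι} (hUW : U ⊆ W) (hγ : 0 < γ) (L : ι → ℝ)
    (hj : j ∈ U) (hx : 0 ≤ x)
    (hσ : root W γ L j ^ 4 * x ≤ γ * ∑ i ∈ W, root W γ L i ^ 4) :
    stability W γ L j x - stability U γ L j x ≤
      24 / γ * (∑ i ∈ W \ U, root W γ L i ^ 4) * root W γ L j ^ 8 /
        ((∑ i ∈ U, root W γ L i ^ 4) * ∑ i ∈ W, root W γ L i ^ 4) * x ^ 2 := by
  have hU : U.Nonempty := ⟨j, hj⟩
  have hW := hU.mono hUW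
  have hjW := hUW hj
  set A := ∑ i ∈ U, root W γ L i ^ 4 with hA
  set S := ∑ i ∈ W, root W γ L i ^ 4 with hS
  set B := ∑ i ∈ W \ U, root W γ L i ^ 4 with hB
  have hup : ∀ i ∈ W, 0 < root W γ L i := fun i hi => root_pos hW hγ L hi
  have hA0 : 0 < A := Finset.sum_pos (fun i hi => pow_pos (hup i (hUW hi)) 4) hU
  have hS0 : 0 < S := Finset.sum_pos (fun i hi => pow_pos (hup i hi) 4) hW
  have hB0 : 0 ≤ B :=
    Finset.sum_nonneg fun i hi => pow_nonneg (hup i (Finset.sdiff_subset hi)).le 4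
  have huj := hup j hjW
  set b := 24 / γ * (root W γ L j ^ 4 * x / S) * B * root W γ L j ^ 4 / A with hb
  have hdrop : ∀ y ∈ Set.Icc 0 x,
      (root W γ L j ^ 3 - root W γ (L + Pi.single j y) j ^ 3) -
      (root U γ L j ^ 3 - root U γ (L + Pi.single j y) j ^ 3) ≤ b := by
    intro y hy
    have h1 := multiplier_shift_mul_le hγ L hjW y
    have h2 : multiplier W γ (L + Pi.single j y) - multiplier W γ L ≤ root W γ L j ^ 4 * x / S := by
      rw [le_div_iff₀ hS0]
      exact h1.trans (mul_le_mul_of_nonneg_left hy.2 (by positivity))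
    have h3 : root W γ L j ^ 4 * x / S ≤ γ := by rwa [div_le_iff₀ hS0]
    have h4 := weight_drop_sub_mul_le hUW hγ L hj hy.1 (h2.trans h3)
    rw [hb, le_div_iff₀ hA0]
    refine h4.trans ?_
    gcongr
  -- Integration of the drop bound `b`: `E` vanishes at `0` and has a nonnegative derivative on the
  -- interior of `[0, x]`.
  set E : ℝ → ℝ := fun y => b * y - (stability W γ L j y - stability U γ L j y) with hE
  have hderiv : ∀ y, HasDerivAt E (b - ((root W γ L j ^ 3 - root W γ (L + Pi.single j y) j ^ 3) -
      (root U γ L j ^ 3 - root U γ (L + Pi.single j y) j ^ 3))) y := by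
    intro y
    have h1 := hasDerivAt_value hγ L hjW y
    have h2 := hasDerivAt_value hγ L hj y
    have h0 := hasDerivAt_id y
    have h3 := (h0.const_mul b).sub ((((h0.const_mul (root W γ L j ^ 3)).add_const
      (value W γ L)).sub h1).sub (((h0.const_mul (root U γ L j ^ 3)).add_const
      (value U γ L)).sub h2))
    simp only [hE, stability, if_pos hj, if_pos hjW]
    refine h3.congr_deriv ?_
    ring
  have hmono : MonotoneOn E (Set.Icc 0 x) := by
    refine monotoneOn_of_deriv_nonneg (convex_Icc 0 x)
      (fun y _ => (hderiv y).continuousAt.continuousWithinAt)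
      (fun y _ => (hderiv y).differentiableAt.differentiableWithinAt) fun y hy => ?_
    rw [(hderiv y).deriv]
    linarith [hdrop y (interior_subset hy)]
  have h := hmono (Set.left_mem_Icc.2 hx) (Set.right_mem_Icc.2 hx) hx
  have h0 : E 0 = 0 := by simp [hE, stability]
  rw [h0] at h
  have h5 : b * x = 24 / γ * B * root W γ L j ^ 8 / (A * S) * x ^ 2 := by
    rw [hb]; field_simp
  rw [← h5]
  simp only [hE] at h
  linarith

end Stability

/-! ### Inequalities between power sums. -/

section PowerMeans

variable {ι : Type*} {U : Finset ι} {u : ι → ℝ}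

/-- Cauchy–Schwarz for `u³ = u * u²`. -/
theorem one_le_sum_sq_mul_sum_pow_four (h : ∑ i ∈ U, u i ^ 3 = 1) :
    1 ≤ (∑ i ∈ U, u i ^ 2) * ∑ i ∈ U, u i ^ 4 := by
  have := Finset.sum_mul_sq_le_sq_mul_sq U u (fun i => u i ^ 2)
  calc (1 : ℝ) = (∑ i ∈ U, u i * u i ^ 2) ^ 2 := by
        rw [← one_pow 2, ← h]
        congr 1
        exact Finset.sum_congr rfl fun i _ => by ring
    _ ≤ _ := this
    _ = _ := by
        congr 1
        exact Finset.sum_congr rfl fun i _ => by ring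

theorem sq_sum_pow_six_le (hu : ∀ i ∈ U, 0 ≤ u i) :
    (∑ i ∈ U, u i ^ 6) ^ 2 ≤ (∑ i ∈ U, u i ^ 4) ^ 3 := by
  have h1 := Finset.sum_mul_sq_le_sq_mul_sq U (fun i => u i ^ 2) (fun i => u i ^ 4)
  have h2 : ∑ i ∈ U, (u i ^ 4) ^ 2 ≤ (∑ i ∈ U, u i ^ 4) ^ 2 :=
    Finset.sum_sq_le_sq_sum_of_nonneg fun i hi => pow_nonneg (hu i hi) 4
  have h3 : ∑ i ∈ U, u i ^ 2 * u i ^ 4 = ∑ i ∈ U, u i ^ 6 :=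
    Finset.sum_congr rfl fun i _ => by ring
  have h4 : ∑ i ∈ U, (u i ^ 2) ^ 2 = ∑ i ∈ U, u i ^ 4 :=
    Finset.sum_congr rfl fun i _ => by ring
  rw [h3, h4] at h1
  have h5 : 0 ≤ ∑ i ∈ U, u i ^ 4 := Finset.sum_nonneg fun i hi => pow_nonneg (hu i hi) 4
  calc _ ≤ _ := h1
    _ ≤ (∑ i ∈ U, u i ^ 4) * (∑ i ∈ U, u i ^ 4) ^ 2 := mul_le_mul_of_nonneg_left h2 h5
    _ = _ := by ring

theorem sum_pow_four_le_sq (hu : ∀ i ∈ U, 0 ≤ u i) :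
    ∑ i ∈ U, u i ^ 4 ≤ (∑ i ∈ U, u i ^ 2) ^ 2 := by
  have h2 : ∑ i ∈ U, (u i ^ 2) ^ 2 ≤ (∑ i ∈ U, u i ^ 2) ^ 2 :=
    Finset.sum_sq_le_sq_sum_of_nonneg fun i hi => pow_nonneg (hu i hi) 2
  refine le_trans (le_of_eq ?_) h2
  exact Finset.sum_congr rfl fun i _ => by ring

/-- The power mean inequality between the exponents `2` and `3`, where `k` bounds the cube root of
the number of terms. -/
theorem sum_sq_le_of_card_le {k : ℝ} (hk : 0 < k) (hcard : (U.card : ℝ) ≤ k ^ 3)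
    (hu : ∀ i ∈ U, 0 ≤ u i) (h : ∑ i ∈ U, u i ^ 3 = 1) : ∑ i ∈ U, u i ^ 2 ≤ k := by
  -- Tangent at `k⁻¹`, the root of the uniform distribution on `k ^ 3` arms.
  have h1 : ∀ i ∈ U, u i ^ 2 ≤ 1 / (3 * k ^ 2) + 2 * k / 3 * u i ^ 3 := by
    intro i hi
    have := sq_le_tangent (inv_pos.2 hk) (hu i hi)
    refine this.trans (le_of_eq ?_)
    field_simp
    ring
  refine (Finset.sum_le_sum h1).trans ?_
  rw [Finset.sum_add_distrib, ← Finset.mul_sum, h, Finset.sum_const, nsmul_eq_mul]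
  have h2 : (U.card : ℝ) * (1 / (3 * k ^ 2)) ≤ k ^ 3 * (1 / (3 * k ^ 2)) :=
    mul_le_mul_of_nonneg_right hcard (by positivity)
  have h3 : k ^ 3 * (1 / (3 * k ^ 2)) = k / 3 := by field_simp
  linarith

end PowerMeans

/-! ### Learning rates and sums of powers of the round. -/

section Rate

variable {K : ℕ} [NeZero K]

/-- The sixth root of the number of arms. -/
def sixthRoot (K : ℕ) : ℝ := (K : ℝ) ^ (1 / 6 : ℝ)

theorem one_le_sixthRoot : 1 ≤ sixthRoot K :=
  Real.one_le_rpow (by exact_mod_cast Nat.one_le_iff_ne_zero.2 (NeZero.ne K)) (by norm_num)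

theorem sixthRoot_pow {K : ℕ} : sixthRoot K ^ 6 = K := by
  rw [sixthRoot, ← Real.rpow_natCast, ← Real.rpow_mul (Nat.cast_nonneg K)]
  norm_num

theorem rate_eq {K : ℕ} (t : ℕ) : rate K t = sixthRoot K * √((t : ℝ) + 1) := rfl

theorem sum_root_sq_le {γ : ℝ} (hγ : 0 < γ) (L : Fin K → ℝ) {U : Finset (Fin K)}
    (hU : U.Nonempty) : ∑ i ∈ U, root U γ L i ^ 2 ≤ sixthRoot K ^ 2 := by
  have h1 := one_le_sixthRoot (K := K)
  refine sum_sq_le_of_card_le (by positivity) ?_ (fun i hi => (root_pos hU hγ L hi).le)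
    (sum_root_cube hU hγ L)
  rw [← pow_mul, sixthRoot_pow]
  exact_mod_cast (Finset.card_le_univ U).trans_eq (Fintype.card_fin K)

theorem sum_inv_sqrt_le (T : ℕ) : ∑ t ∈ Finset.range T, 1 / √((t : ℝ) + 1) ≤ 2 * √T := by
  induction T with
  | zero => simp
  | succ n ih =>
    rw [Finset.sum_range_succ]
    have h1 : 0 < √((n : ℝ) + 1) := Real.sqrt_pos.2 (by positivity)
    have h2 : √((n : ℝ) + 1) ^ 2 = n + 1 := Real.sq_sqrt (by positivity)
    have h3 : √(n : ℝ) ^ 2 = n := Real.sq_sqrt (by positivity)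
    have h4 : 1 / √((n : ℝ) + 1) ≤ 2 * √((n : ℝ) + 1) - 2 * √n := by
      rw [div_le_iff₀ h1]
      nlinarith [sq_nonneg (√((n : ℝ) + 1) - √n)]
    push_cast
    linarith

/-- A telescoping majorant of `t ^ (-3/2)`, used for the tails of the sums over rounds. -/
theorem inv_mul_sqrt_le (n : ℕ) : 1 / (((n : ℝ) + 2) * √((n : ℝ) + 2)) ≤
    2 / √((n : ℝ) + 1) - 2 / √((n : ℝ) + 2) := by
  have h1 : 0 < √((n : ℝ) + 1) := Real.sqrt_pos.2 (by positivity)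
  have h1' : 0 < √((n : ℝ) + 2) := Real.sqrt_pos.2 (by positivity)
  have h2 : √((n : ℝ) + 1) ^ 2 = n + 1 := Real.sq_sqrt (by positivity)
  have h3 : √((n : ℝ) + 2) ^ 2 = n + 2 := Real.sq_sqrt (by positivity)
  have hab : √((n : ℝ) + 1) ≤ √((n : ℝ) + 2) := Real.sqrt_le_sqrt (by linarith)
  set a := √((n : ℝ) + 1)
  set b := √((n : ℝ) + 2)
  have hb : (n : ℝ) + 2 = b ^ 2 := h3.symm
  rw [hb, div_sub_div _ _ h1.ne' h1'.ne', div_le_div_iff₀ (by positivity) (by positivity)]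
  have h5 : (b - a) * (b + a) = 1 := by nlinarith
  have h6 : 1 ≤ (b - a) * (2 * b) := by nlinarith
  nlinarith [mul_pos h1 h1', mul_pos (mul_pos h1 h1') h1']

theorem sum_inv_mul_sqrt_le (T : ℕ) :
    ∑ t ∈ Finset.range T, 1 / (((t : ℝ) + 1) * √((t : ℝ) + 1)) ≤ 3 := by
  have h : ∀ n : ℕ, ∑ t ∈ Finset.range (n + 1), 1 / (((t : ℝ) + 1) * √((t : ℝ) + 1)) ≤
      3 - 2 / √((n : ℝ) + 1) := by
    intro n
    induction n with
    | zero => norm_num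
    | succ n ih =>
      rw [Finset.sum_range_succ]
      have h1 := inv_mul_sqrt_le n
      push_cast
      rw [add_assoc (n : ℝ) 1 1, one_add_one_eq_two]
      linarith
  cases T with
  | zero => simp
  | succ n =>
    refine (h n).trans ?_
    have : 0 ≤ 2 / √((n : ℝ) + 1) := by positivity
    linarith

end Rate

/-! ### Pathwise comparison of the algorithm with FTRL on a face. -/

section Pathwise

variable {K : ℕ} [NeZero K]

/-- The weight of arm `j` in the FTRL distribution on the simplex over `U`. -/
def weight (U : Finset (Fin K)) (γ : ℝ) (L : Fin K → ℝ) (j : Fin K) : ℝ :=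
  if j ∈ U then root U γ L j ^ 3 else 0

/-- The cube root of the exploitation probability of arm `j` in round `t + 1`. -/
def armRoot (t : ℕ) (L : Fin K → ℝ) (j : Fin K) : ℝ := root Finset.univ (rate K t) L j

theorem armRoot_pos (t : ℕ) (L : Fin K → ℝ) (j : Fin K) : 0 < armRoot t L j :=
  root_pos Finset.univ_nonempty (rate_pos t) L (Finset.mem_univ j)

theorem sum_armRoot_cube (t : ℕ) (L : Fin K → ℝ) : ∑ i, armRoot t L i ^ 3 = 1 :=
  sum_root_cube Finset.univ_nonempty (rate_pos t) L

theorem sum_armRoot_sq_le (t : ℕ) (L : Fin K → ℝ) : ∑ i, armRoot t L i ^ 2 ≤ sixthRoot K ^ 2 :=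
  sum_root_sq_le (rate_pos t) L Finset.univ_nonempty

theorem sum_armRoot_pow_pos (t : ℕ) (L : Fin K → ℝ) (n : ℕ) {U : Finset (Fin K)}
    (hU : U.Nonempty) : 0 < ∑ i ∈ U, armRoot t L i ^ n :=
  Finset.sum_pos (fun i _ => pow_pos (armRoot_pos t L i) n) hU

theorem explore_eq (t : ℕ) (L : Fin K → ℝ) (i : Fin K) :
    explore (ftrl t L) i = armRoot t L i ^ 2 / ∑ k, armRoot t L k ^ 2 :=
  explore_ftrl t L i

theorem explore_pos (t : ℕ) (L : Fin K → ℝ) (i : Fin K) : 0 < explore (ftrl t L) i := by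
  rw [explore_eq]
  exact div_pos (pow_pos (armRoot_pos t L i) 2) (sum_armRoot_pow_pos t L 2 Finset.univ_nonempty)

/-- The factor of the squared loss estimate in the bound on the difference of the stability terms of
the simplex and of its face over `U`. -/
def stabCoeff (U : Finset (Fin K)) (t : ℕ) (L : Fin K → ℝ) (j : Fin K) : ℝ :=
  if j ∈ U ∧ K ≤ t + 1 then
    24 / rate K t * (∑ i ∈ Finset.univ \ U, armRoot t L i ^ 4) * armRoot t L j ^ 8 /
        ((∑ i ∈ U, armRoot t L i ^ 4) * ∑ i, armRoot t L i ^ 4)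
  else 3 / (2 * rate K t) * armRoot t L j ^ 4

theorem stabCoeff_nonneg (U : Finset (Fin K)) (t : ℕ) (L : Fin K → ℝ) (j : Fin K) :
    0 ≤ stabCoeff U t L j := by
  have h : ∀ (n : ℕ) (W : Finset (Fin K)), 0 ≤ ∑ i ∈ W, armRoot t L i ^ n :=
    fun n W => Finset.sum_nonneg fun i _ => pow_nonneg (armRoot_pos t L i).le n
  have h1 := rate_pos (K := K) t
  have h2 := (armRoot_pos t L j).le
  have h3 := h 4 U
  have h4 := h 4 (Finset.univ \ U)
  have h5 := h 4 Finset.univ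
  unfold stabCoeff
  split_ifs <;> positivity

/-- After `K` rounds a loss estimate moves the multiplier by at most the learning rate. -/
theorem shift_condition {t : ℕ} (ht : K ≤ t + 1) (L : Fin K → ℝ) (j : Fin K) :
    armRoot t L j ^ 4 * (1 / explore (ftrl t L) j) ≤ rate K t * ∑ i, armRoot t L i ^ 4 := by
  have hγ := rate_pos (K := K) t
  set A := ∑ i, armRoot t L i ^ 4
  set S := ∑ i, armRoot t L i ^ 2 with hS
  have hS0 : 0 < S := sum_armRoot_pow_pos t L 2 Finset.univ_nonempty
  have hA0 : 0 < A := sum_armRoot_pow_pos t L 4 Finset.univ_nonempty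
  have hu := armRoot_pos t L j
  have hSA : 1 ≤ S * A := one_le_sum_sq_mul_sum_pow_four (sum_armRoot_cube t L)
  have huA : armRoot t L j ^ 4 ≤ A :=
    Finset.single_le_sum (f := fun i => armRoot t L i ^ 4)
      (fun i _ => pow_nonneg (armRoot_pos t L i).le 4) (Finset.mem_univ j)
  have hSK : S ^ 3 ≤ rate K t ^ 2 := by
    have h1 : S ^ 3 ≤ (sixthRoot K ^ 2) ^ 3 := pow_le_pow_left₀ hS0.le (sum_armRoot_sq_le t L) 3
    have h2 : (sixthRoot K ^ 2) ^ 3 = K := by rw [← pow_mul, sixthRoot_pow]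
    have h3 : (K : ℝ) ≤ t + 1 := by exact_mod_cast ht
    rw [rate_eq, mul_pow, Real.sq_sqrt (by positivity)]
    nlinarith [one_le_pow₀ (one_le_sixthRoot (K := K)) (n := 2)]
  rw [explore_eq, ← hS]
  have h1 : armRoot t L j ^ 4 * (1 / (armRoot t L j ^ 2 / S)) = S * armRoot t L j ^ 2 := by
    field_simp
  rw [h1]
  -- After squaring, the factor `S * A ≥ 1` is inserted to reach `S ^ 3 ≤ K * K^(1/3) ≤ rate²`.
  refine le_of_sq_le_sq ?_ (by positivity)
  calc (S * armRoot t L j ^ 2) ^ 2 = S ^ 2 * armRoot t L j ^ 4 := by ring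
    _ ≤ S ^ 2 * A := by gcongr
    _ ≤ S ^ 2 * A * (S * A) := le_mul_of_one_le_right (by positivity) hSA
    _ = S ^ 3 * A ^ 2 := by ring
    _ ≤ rate K t ^ 2 * A ^ 2 := by gcongr
    _ = _ := by ring

theorem stability_sub_le_stabCoeff {U : Finset (Fin K)} (hU : U.Nonempty) (t : ℕ)
    (L : Fin K → ℝ) (j : Fin K) {y : ℝ} (hy : y ∈ Set.Icc (0 : ℝ) 1) :
    stability Finset.univ (rate K t) L j (y / explore (ftrl t L) j) -
      stability U (rate K t) L j (y / explore (ftrl t L) j) ≤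
    stabCoeff U t L j / explore (ftrl t L) j ^ 2 := by
  have hγ := rate_pos (K := K) t
  have hg := explore_pos t L j
  have hx : 0 ≤ y / explore (ftrl t L) j := div_nonneg hy.1 hg.le
  have hx1 : y / explore (ftrl t L) j ≤ 1 / explore (ftrl t L) j :=
    div_le_div_of_nonneg_right hy.2 hg.le
  suffices h : stability Finset.univ (rate K t) L j (y / explore (ftrl t L) j) -
      stability U (rate K t) L j (y / explore (ftrl t L) j) ≤
      stabCoeff U t L j * (y / explore (ftrl t L) j) ^ 2 by
    refine h.trans ?_
    rw [div_eq_mul_one_div (stabCoeff U t L j), ← one_div_pow]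
    exact mul_le_mul_of_nonneg_left (pow_le_pow_left₀ hx hx1 2) (stabCoeff_nonneg U t L j)
  unfold stabCoeff
  split_ifs with hc
  · refine stability_sub_le (Finset.subset_univ U) hγ L hc.1 hx ?_
    refine le_trans ?_ (shift_condition hc.2 L j)
    exact mul_le_mul_of_nonneg_left hx1 (pow_nonneg (armRoot_pos t L j).le 4)
  · have h1 := stability_le hγ L (Finset.mem_univ j) hx
    have h2 := stability_nonneg hU hγ L j (y / explore (ftrl t L) j)
    exact (sub_le_self _ h2).trans h1

/-- Averaging over the explored arm leaves one division by `explore`. The constant `14` covers `24 /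
2` from the arms in `U` and `3 / 2` from the others; the early rounds take the crude coefficient for
every arm. -/
theorem sum_stabCoeff_div_le {U : Finset (Fin K)} (hU : U.Nonempty) (t : ℕ) (L : Fin K → ℝ) :
    ∑ j, stabCoeff U t L j / explore (ftrl t L) j ≤
      14 * sixthRoot K / √((t : ℝ) + 1) * ∑ i ∈ Finset.univ \ U, armRoot t L i ^ 2 +
        if t + 1 < K then 2 * sixthRoot K ^ 3 / √((t : ℝ) + 1) else 0 := by
  have hγ := rate_pos (K := K) t
  have hκ := one_le_sixthRoot (K := K)
  have hr : 0 < √((t : ℝ) + 1) := Real.sqrt_pos.2 (by positivity)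
  set S := ∑ i, armRoot t L i ^ 2 with hS
  have hS0 : 0 < S := sum_armRoot_pow_pos t L 2 Finset.univ_nonempty
  have hSK : S ≤ sixthRoot K ^ 2 := sum_armRoot_sq_le t L
  have hSγ : S / rate K t ≤ sixthRoot K / √((t : ℝ) + 1) := by
    rw [rate_eq, div_le_div_iff₀ (by positivity) hr]
    nlinarith
  have hV : 0 ≤ ∑ i ∈ Finset.univ \ U, armRoot t L i ^ 2 :=
    Finset.sum_nonneg fun i _ => pow_nonneg (armRoot_pos t L i).le 2
  have hcrude : ∀ j, 3 / (2 * rate K t) * armRoot t L j ^ 4 / explore (ftrl t L) j =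
      3 / 2 * (S / rate K t) * armRoot t L j ^ 2 := by
    intro j
    have := armRoot_pos t L j
    rw [explore_eq, ← hS]
    field_simp
  by_cases ht : K ≤ t + 1
  · rw [if_neg (not_lt.2 ht), add_zero, ← Finset.sum_sdiff (Finset.subset_univ U)]
    set A := ∑ i ∈ U, armRoot t L i ^ 4 with hA
    set B := ∑ i ∈ Finset.univ \ U, armRoot t L i ^ 4 with hB
    have hA0 : 0 < A := sum_armRoot_pow_pos t L 4 hU
    have hB0 : 0 ≤ B := Finset.sum_nonneg fun i _ => pow_nonneg (armRoot_pos t L i).le 4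
    have htot : ∑ i, armRoot t L i ^ 4 = A + B := by
      rw [← Finset.sum_sdiff (Finset.subset_univ U), add_comm]
    have h1 : ∑ j ∈ Finset.univ \ U, stabCoeff U t L j / explore (ftrl t L) j =
        3 / 2 * (S / rate K t) * ∑ i ∈ Finset.univ \ U, armRoot t L i ^ 2 := by
      rw [Finset.mul_sum]
      refine Finset.sum_congr rfl fun j hj => ?_
      rw [stabCoeff, if_neg fun h => (Finset.mem_sdiff.1 hj).2 h.1, hcrude]
    have h2 : ∑ j ∈ U, stabCoeff U t L j / explore (ftrl t L) j =
        24 * (S / rate K t) * (B * (∑ i ∈ U, armRoot t L i ^ 6) / (A * (A + B))) := by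
      refine (Finset.sum_congr rfl fun j hj => ?_).trans
        (by simp only [← Finset.sum_div, ← Finset.mul_sum] :
          ∑ j ∈ U, 24 * (S / rate K t) * (B * armRoot t L j ^ 6 / (A * (A + B))) = _)
      have := armRoot_pos t L j
      rw [stabCoeff, if_pos ⟨hj, ht⟩, explore_eq, ← hS, ← hA, ← hB, htot]
      field_simp
    have h3 : B * (∑ i ∈ U, armRoot t L i ^ 6) / (A * (A + B)) ≤
        1 / 2 * ∑ i ∈ Finset.univ \ U, armRoot t L i ^ 2 := by
      rw [div_le_iff₀ (by positivity)]
      have h6 := sq_sum_pow_six_le (U := U) (u := armRoot t L) fun i _ => (armRoot_pos t L i).le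
      have h7 := sum_pow_four_le_sq (U := (Finset.univ : Finset (Fin K)) \ U) (u := armRoot t L)
        fun i _ => (armRoot_pos t L i).le
      rw [← hA] at h6
      rw [← hB] at h7
      -- In essence `B * A^(3/2) / (A * (A + B)) ≤ √B / 2` by AM-GM; squaring avoids the roots.
      refine le_of_sq_le_sq ?_ (by positivity)
      calc (B * ∑ i ∈ U, armRoot t L i ^ 6) ^ 2 = B ^ 2 * (∑ i ∈ U, armRoot t L i ^ 6) ^ 2 := by
            ring
        _ ≤ B ^ 2 * A ^ 3 := by gcongr
        _ = B * A ^ 2 * (A * B) := by ring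
        _ ≤ B * A ^ 2 * ((A + B) ^ 2 / 4) := by
            refine mul_le_mul_of_nonneg_left ?_ (by positivity)
            nlinarith [sq_nonneg (A - B)]
        _ ≤ (∑ i ∈ Finset.univ \ U, armRoot t L i ^ 2) ^ 2 * A ^ 2 * ((A + B) ^ 2 / 4) := by
            gcongr
        _ = _ := by ring
    have h8 : S / rate K t * ∑ i ∈ Finset.univ \ U, armRoot t L i ^ 2 ≤
        sixthRoot K / √((t : ℝ) + 1) * ∑ i ∈ Finset.univ \ U, armRoot t L i ^ 2 := by gcongr
    have h9 := mul_le_mul_of_nonneg_left h3 (show 0 ≤ S / rate K t by positivity)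
    have h10 : 14 * sixthRoot K / √((t : ℝ) + 1) * ∑ i ∈ Finset.univ \ U, armRoot t L i ^ 2 =
      14 * (sixthRoot K / √((t : ℝ) + 1) * ∑ i ∈ Finset.univ \ U, armRoot t L i ^ 2) := by ring
    have h11 : 0 ≤ S / rate K t * ∑ i ∈ Finset.univ \ U, armRoot t L i ^ 2 := by positivity
    rw [h1, h2, h10]
    linarith
  · have h1 : ∑ j, stabCoeff U t L j / explore (ftrl t L) j = 3 / 2 * (S / rate K t) * S := by
      rw [hS, Finset.mul_sum]
      refine Finset.sum_congr rfl fun j hj => ?_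
      rw [stabCoeff, if_neg fun h => ht h.2, hcrude]
    rw [h1, if_pos (not_le.1 ht)]
    have h2 : S / rate K t * S ≤ sixthRoot K / √((t : ℝ) + 1) * sixthRoot K ^ 2 := by gcongr
    have h3 : sixthRoot K / √((t : ℝ) + 1) * sixthRoot K ^ 2 =
        sixthRoot K ^ 3 / √((t : ℝ) + 1) := by ring
    have h4 : 0 ≤ sixthRoot K ^ 3 / √((t : ℝ) + 1) := by positivity
    have h5 : 2 * sixthRoot K ^ 3 / √((t : ℝ) + 1) = 2 * (sixthRoot K ^ 3 / √((t : ℝ) + 1)) := by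
      ring
    have h6 : 0 ≤ 14 * sixthRoot K / √((t : ℝ) + 1) *
      ∑ i ∈ Finset.univ \ U, armRoot t L i ^ 2 := by positivity
    rw [h5]
    linarith

/-- The difference (nonpositive) of the FTRL values on the simplex and on its face over `U`. -/
def valueGap (U : Finset (Fin K)) (t : ℕ) (L : Fin K → ℝ) : ℝ :=
  value Finset.univ (rate K t) L - value U (rate K t) L

/-- The cost in round `t + 1` of the increase of the learning rate. -/
def penalty (U : Finset (Fin K)) (t : ℕ) (L : Fin K → ℝ) : ℝ :=
  3 * sixthRoot K / √((t : ℝ) + 1) * ∑ i ∈ Finset.univ \ U, armRoot t L i ^ 2 +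
    6 * sixthRoot K ^ 3 * (1 / (((t : ℝ) + 1) * √((t : ℝ) + 1)))

/-- Raising the rate changes each optimal value by about `3δ ∑ u²`. On the arms of `U` the two sums
cancel up to a relative error `1 / (t + 1)`, which leaves a summable `t ^ (-3/2)` term. -/
theorem valueGap_sub_le {U : Finset (Fin K)} (hU : U.Nonempty) (t : ℕ) (L : Fin K → ℝ) :
    valueGap U t L - valueGap U (t + 1) L ≤ penalty U (t + 1) L := by
  have hγ := rate_pos (K := K) t
  have hγ' := rate_pos (K := K) (t + 1)
  have hκ := one_le_sixthRoot (K := K)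
  have hr : 0 < √((t : ℝ) + 1) := Real.sqrt_pos.2 (by positivity)
  have hr' : 0 < √((t : ℝ) + 2) := Real.sqrt_pos.2 (by positivity)
  have hrr : √((t : ℝ) + 1) ≤ √((t : ℝ) + 2) := Real.sqrt_le_sqrt (by linarith)
  have hr2 : √((t : ℝ) + 1) ^ 2 = t + 1 := Real.sq_sqrt (by positivity)
  have hr2' : √((t : ℝ) + 2) ^ 2 = t + 2 := Real.sq_sqrt (by positivity)
  have hrate : rate K (t + 1) = sixthRoot K * √((t : ℝ) + 2) := by
    rw [rate_eq]; push_cast; congr 2; ring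
  have hle : rate K t ≤ rate K (t + 1) := by
    rw [hrate, rate_eq]; gcongr
  have h1 := value_mono_rate hγ' hγ L (Finset.univ_nonempty (α := Fin K))
  have h2 := value_mono_rate hγ hγ' L hU
  set δ := rate K (t + 1) - rate K t with hδ
  have hδ0 : 0 ≤ δ := sub_nonneg.2 hle
  have hδ1 : δ ≤ sixthRoot K / √((t : ℝ) + 2) := by
    rw [hδ, hrate, rate_eq, le_div_iff₀ hr', ← mul_sub, mul_assoc]
    refine mul_le_of_le_one_right (by linarith) ?_
    nlinarith
  have h3 : ∑ i ∈ U, armRoot (t + 1) L i ^ 2 ≤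
      ∑ i ∈ U, root U (rate K t) L i ^ 2 + 2 * sixthRoot K ^ 2 / ((t : ℝ) + 2) := by
    -- Passing to the face enlarges the roots; changing the rate costs the squared ratio of rates,
    -- `(t + 2) / (t + 1)`.
    have h4 : ∑ i ∈ U, armRoot (t + 1) L i ^ 2 ≤
        ∑ i ∈ U, (1 + 1 / ((t : ℝ) + 1)) * root U (rate K t) L i ^ 2 := by
      refine Finset.sum_le_sum fun i hi => ?_
      have h5 := root_le_root_subset (Finset.subset_univ U) hγ' L hi
      have h6 := root_le_rate_mul_root hγ hle L hi
      have h7 := pow_le_pow_left₀ (armRoot_pos (t + 1) L i).le (h5.trans h6) 2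
      refine h7.trans (le_of_eq ?_)
      rw [mul_pow, div_pow, hrate, rate_eq, mul_pow, mul_pow, hr2, hr2']
      field_simp
      ring
    refine h4.trans ?_
    rw [← Finset.mul_sum, add_mul, one_mul]
    have h5 := sum_root_sq_le hγ L hU
    have h6 : 1 / ((t : ℝ) + 1) * ∑ i ∈ U, root U (rate K t) L i ^ 2 ≤
        1 / ((t : ℝ) + 1) * sixthRoot K ^ 2 := by gcongr
    have h7 : 1 / ((t : ℝ) + 1) * sixthRoot K ^ 2 ≤ 2 * sixthRoot K ^ 2 / ((t : ℝ) + 2) := by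
      rw [one_div_mul_eq_div, div_le_div_iff₀ (by positivity) (by positivity)]
      nlinarith [sq_nonneg (sixthRoot K),
        mul_nonneg (sq_nonneg (sixthRoot K)) (Nat.cast_nonneg (α := ℝ) t)]
    linarith
  have h4 : ∑ i, armRoot (t + 1) L i ^ 2 = ∑ i ∈ Finset.univ \ U, armRoot (t + 1) L i ^ 2 +
      ∑ i ∈ U, armRoot (t + 1) L i ^ 2 := (Finset.sum_sdiff (Finset.subset_univ U)).symm
  have hV : 0 ≤ ∑ i ∈ Finset.univ \ U, armRoot (t + 1) L i ^ 2 :=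
    Finset.sum_nonneg fun i _ => pow_nonneg (armRoot_pos (t + 1) L i).le 2
  calc valueGap U t L - valueGap U (t + 1) L
      ≤ 3 * δ * (∑ i, armRoot (t + 1) L i ^ 2 - ∑ i ∈ U, root U (rate K t) L i ^ 2) := by
        have h8 : rate K t - rate K (t + 1) = -δ := by rw [hδ]; ring
        rw [h8] at h2
        have h9 : ∑ i, armRoot (t + 1) L i ^ 2 =
          ∑ i, root Finset.univ (rate K (t + 1)) L i ^ 2 := rfl
        rw [valueGap, valueGap, h9]
        linarith
    _ ≤ 3 * δ * (∑ i ∈ Finset.univ \ U, armRoot (t + 1) L i ^ 2 +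
          2 * sixthRoot K ^ 2 / ((t : ℝ) + 2)) :=
        mul_le_mul_of_nonneg_left (by linarith) (by positivity)
    _ ≤ 3 * (sixthRoot K / √((t : ℝ) + 2)) * (∑ i ∈ Finset.univ \ U, armRoot (t + 1) L i ^ 2 +
          2 * sixthRoot K ^ 2 / ((t : ℝ) + 2)) := by gcongr
    _ = penalty U (t + 1) L := by
        rw [penalty]
        push_cast
        rw [add_assoc (t : ℝ) 1 1, one_add_one_eq_two]
        field_simp
        ring

theorem neg_valueGap_zero_le (U : Finset (Fin K)) :
    -valueGap U 0 0 ≤ 3 * sixthRoot K ^ 3 := by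
  have h1 := sum_armRoot_sq_le (K := K) 0 0
  have hκ := one_le_sixthRoot (K := K)
  have h2 : rate K 0 = sixthRoot K := by rw [rate_eq]; simp
  have h3 : 0 ≤ ∑ i ∈ U, root U (rate K 0) 0 i ^ 2 := Finset.sum_nonneg fun i _ => sq_nonneg _
  have h4 : 0 ≤ 3 * rate K 0 * ∑ i ∈ U, root U (rate K 0) 0 i ^ 2 := by
    rw [h2]; positivity
  have h5 : 3 * rate K 0 * ∑ i, root Finset.univ (rate K 0) (0 : Fin K → ℝ) i ^ 2 ≤
      3 * rate K 0 * sixthRoot K ^ 2 :=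
    mul_le_mul_of_nonneg_left h1 (by rw [h2]; positivity)
  simp only [valueGap, value, Pi.zero_apply, mul_zero, Finset.sum_const_zero, zero_sub]
  rw [h2] at *
  linarith

theorem cumEst_succ (j : ℕ → Fin K) (y : ℕ → ℝ) (t : ℕ) : cumEst j y (t + 1) =
    cumEst j y t + Pi.single (j t) (y t / explore (ftrl t (cumEst j y t)) (j t)) := by
  funext i
  rw [cumEst, Pi.add_apply, Pi.single_apply]
  by_cases h : j t = i
  · subst h; simp
  · simp [h, Ne.symm h]

/-- The pathwise comparison of the algorithm with FTRL on the face over `U`. -/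
theorem sum_weight_sub_le {U : Finset (Fin K)} (hU : U.Nonempty) (j : ℕ → Fin K) (y : ℕ → ℝ)
    (T : ℕ) (hy : ∀ t < T, y t ∈ Set.Icc (0 : ℝ) 1) :
    ∑ t ∈ Finset.range T, (weight Finset.univ (rate K t) (cumEst j y t) (j t) -
        weight U (rate K t) (cumEst j y t) (j t)) * (y t / explore (exploitDist j y t) (j t)) ≤
      ∑ t ∈ Finset.range T, (stabCoeff U t (cumEst j y t) (j t) /
        explore (exploitDist j y t) (j t) ^ 2 + penalty U t (cumEst j y t)) +
      3 * sixthRoot K ^ 3 := by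
  have hκ := one_le_sixthRoot (K := K)
  -- The difference of the two stability terms is the left side plus the decrease of `valueGap` at
  -- fixed rate.
  have hstep : ∀ t < T, (weight Finset.univ (rate K t) (cumEst j y t) (j t) -
        weight U (rate K t) (cumEst j y t) (j t)) * (y t / explore (exploitDist j y t) (j t)) ≤
      stabCoeff U t (cumEst j y t) (j t) / explore (exploitDist j y t) (j t) ^ 2 +
        valueGap U t (cumEst j y (t + 1)) - valueGap U t (cumEst j y t) := by
    intro t ht
    have h := stability_sub_le_stabCoeff hU t (cumEst j y t) (j t) (hy t ht)
    rw [cumEst_succ]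
    simp only [stability] at h
    simp only [exploitDist, weight, valueGap]
    linarith
  have hpen : ∀ t L, 0 ≤ penalty U t L := by
    intro t L
    have hV : 0 ≤ ∑ i ∈ Finset.univ \ U, armRoot t L i ^ 2 :=
      Finset.sum_nonneg fun i _ => pow_nonneg (armRoot_pos t L i).le 2
    unfold penalty
    positivity
  -- The value gaps telescope. The last one, kept for the induction, is nonpositive and dropped at
  -- the end; the penalty of index `0` is pure slack.
  have hmain : ∀ n, n + 1 ≤ T → ∑ t ∈ Finset.range (n + 1),
      (weight Finset.univ (rate K t) (cumEst j y t) (j t) -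
        weight U (rate K t) (cumEst j y t) (j t)) * (y t / explore (exploitDist j y t) (j t)) ≤
      ∑ t ∈ Finset.range (n + 1), (stabCoeff U t (cumEst j y t) (j t) /
        explore (exploitDist j y t) (j t) ^ 2 + penalty U t (cumEst j y t)) +
      3 * sixthRoot K ^ 3 + valueGap U n (cumEst j y (n + 1)) := by
    intro n
    induction n with
    | zero =>
      intro hn
      have h1 := hstep 0 hn
      have h2 : -valueGap U 0 (cumEst j y 0) ≤ 3 * sixthRoot K ^ 3 := neg_valueGap_zero_le U
      have h3 := hpen 0 (cumEst j y 0)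
      simp only [zero_add, Finset.sum_range_one] at *
      linarith
    | succ n ih =>
      intro hn
      have h0 := ih (by omega)
      have h1 := hstep (n + 1) (by omega)
      have h2 := valueGap_sub_le hU n (cumEst j y (n + 1))
      rw [Finset.sum_range_succ, Finset.sum_range_succ _ (n + 1)]
      linarith
  cases T with
  | zero => simp; positivity
  | succ n =>
    have h := hmain n le_rfl
    have : valueGap U n (cumEst j y (n + 1)) ≤ 0 :=
      sub_nonpos.2 (value_anti_subset hU (Finset.subset_univ U) (rate_pos n) _)
    linarith

end Pathwise

/-! ### Continuity in the loss estimates, and their boundedness. -/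

section Continuity

variable {K : ℕ} [NeZero K]

theorem continuous_armRoot (t : ℕ) (i : Fin K) : Continuous fun L => armRoot t L i :=
  continuous_root (rate_pos t) (Finset.mem_univ i)

theorem continuous_sum_armRoot_pow (t n : ℕ) (U : Finset (Fin K)) :
    Continuous fun L => ∑ i ∈ U, armRoot t L i ^ n :=
  continuous_finsetSum _ fun i _ => (continuous_armRoot t i).pow n

theorem continuous_explore (t : ℕ) (i : Fin K) : Continuous fun L => explore (ftrl t L) i := by
  simp only [explore_eq]
  exact ((continuous_armRoot t i).pow 2).div (continuous_sum_armRoot_pow t 2 _) fun L =>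
    (sum_armRoot_pow_pos t L 2 Finset.univ_nonempty).ne'

theorem continuous_weight (U : Finset (Fin K)) (t : ℕ) (i : Fin K) :
    Continuous fun L => weight U (rate K t) L i := by
  unfold weight
  split_ifs with h
  · exact (continuous_root (rate_pos t) h).pow 3
  · exact continuous_const

theorem continuous_stabCoeff {U : Finset (Fin K)} (hU : U.Nonempty) (t : ℕ) (i : Fin K) :
    Continuous fun L => stabCoeff U t L i := by
  unfold stabCoeff
  split_ifs
  · refine Continuous.div ?_ ((continuous_sum_armRoot_pow t 4 _).mul
      (continuous_sum_armRoot_pow t 4 _)) fun L => ?_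
    · exact (continuous_const.mul (continuous_sum_armRoot_pow t 4 _)).mul
        ((continuous_armRoot t i).pow 8)
    · exact (mul_pos (sum_armRoot_pow_pos t L 4 hU)
        (sum_armRoot_pow_pos t L 4 Finset.univ_nonempty)).ne'
  · exact continuous_const.mul ((continuous_armRoot t i).pow 4)

/-- Inductively the estimates stay in a compact cube, on which the continuous function `1 / explore`
is bounded. The uniformity in the history makes continuous functions of the estimates bounded, hence
integrable. -/
theorem exists_cumEst_le (t : ℕ) : ∃ M : ℝ, ∀ (j : ℕ → Fin K) (y : ℕ → ℝ),
    (∀ s < t, y s ∈ Set.Icc (0 : ℝ) 1) → ∀ i, cumEst j y t i ∈ Set.Icc 0 M := by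
  induction t with
  | zero => exact ⟨0, fun j y _ i => by simp [cumEst]⟩
  | succ t ih =>
    obtain ⟨M, hM⟩ := ih
    have hb : ∀ k, ∃ C, ∀ L ∈ Set.Icc (0 : Fin K → ℝ) (fun _ => M), 1 / explore (ftrl t L) k ≤ C := by
      intro k
      obtain ⟨C, hC⟩ := (isCompact_Icc (a := (0 : Fin K → ℝ)) (b := fun _ => M)).bddAbove_image
        (f := fun L => 1 / explore (ftrl t L) k)
        (continuous_const.div (continuous_explore t k) fun L => (explore_pos t L k).ne').continuousOn
      exact ⟨C, fun L hL => hC ⟨L, hL, rfl⟩⟩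
    choose C hC using hb
    refine ⟨M + ∑ k, |C k|, fun j y hy i => ?_⟩
    have h1 := hM j y (fun s hs => hy s (hs.trans (Nat.lt_succ_self t)))
    have hg := explore_pos t (cumEst j y t) i
    have h2 := hC i (cumEst j y t) ⟨fun k => (h1 k).1, fun k => (h1 k).2⟩
    have h3 : |C i| ≤ ∑ k, |C k| :=
      Finset.single_le_sum (f := fun k => |C k|) (fun k _ => abs_nonneg _) (Finset.mem_univ i)
    have hy' := hy t (Nat.lt_succ_self t)
    have h4 : 0 ≤ y t / explore (ftrl t (cumEst j y t)) i := div_nonneg hy'.1 hg.le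
    have h5 : y t / explore (ftrl t (cumEst j y t)) i ≤ 1 / explore (ftrl t (cumEst j y t)) i :=
      div_le_div_of_nonneg_right hy'.2 hg.le
    have h6 := le_abs_self (C i)
    rw [cumEst]
    beta_reduce
    split_ifs
    · exact ⟨by linarith [(h1 i).1], by linarith [(h1 i).2]⟩
    · exact ⟨by linarith [(h1 i).1], by linarith [(h1 i).2, abs_nonneg (C i)]⟩

end Continuity

/-! ### Averaging over a sampled arm. -/

section Sampling

variable {Ω : Type*} {m' m : MeasurableSpace Ω} {μ : Measure Ω} {K : ℕ}

theorem apply_eq_sum_indicator (X : Ω → Fin K) (h : Ω → Fin K → ℝ) (ω : Ω) :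
    h ω (X ω) = ∑ i, (X ⁻¹' {i}).indicator (fun _ => (1 : ℝ)) ω * h ω i := by
  rw [Finset.sum_eq_single (X ω)]
  · simp
  · intro i _ hi
    rw [Set.indicator_of_notMem (by simpa using hi.symm), zero_mul]
  · simp

theorem measurable_apply_choice {X : Ω → Fin K} (hX : Measurable X) {h : Ω → Fin K → ℝ}
    (hm : ∀ i, Measurable fun ω => h ω i) : Measurable fun ω => h ω (X ω) := by
  simp only [apply_eq_sum_indicator X h]
  refine Finset.measurable_sum _ fun i _ => Measurable.mul ?_ (hm i)
  exact measurable_const.indicator (hX (measurableSet_singleton i))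

theorem integrable_of_abs_le [IsFiniteMeasure μ] {f : Ω → ℝ} (hf : Measurable f) {C : ℝ}
    (hC : ∀ ω, |f ω| ≤ C) : Integrable f μ :=
  Integrable.of_bound hf.aestronglyMeasurable C (Filter.Eventually.of_forall hC)

/-- If `X` has conditional law `w` given `m'`, then it can be averaged out of `m'`-measurable
functions. -/
theorem integral_apply_choice [IsProbabilityMeasure μ] (hle : m' ≤ m) {X : Ω → Fin K}
    (hX : Measurable X) {w : Ω → Fin K → ℝ}
    (hw : ∀ i, μ[(X ⁻¹' {i}).indicator (fun _ => (1 : ℝ)) | m'] =ᵐ[μ] fun ω => w ω i)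
    {h : Ω → Fin K → ℝ} (hm : ∀ i, Measurable[m'] fun ω => h ω i) {C : ℝ}
    (hC : ∀ ω i, |h ω i| ≤ C) :
    ∫ ω, h ω (X ω) ∂μ = ∫ ω, ∑ i, w ω i * h ω i ∂μ := by
  have hind : ∀ i, Integrable ((X ⁻¹' {i}).indicator (fun _ => (1 : ℝ))) μ := fun i =>
    (integrable_const 1).indicator (hX (measurableSet_singleton i))
  have hmul : ∀ i, Integrable
      (fun ω => (X ⁻¹' {i}).indicator (fun _ => (1 : ℝ)) ω * h ω i) μ := fun i =>
    (hind i).mul_bdd ((hm i).mono hle le_rfl).aestronglyMeasurable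
      (Filter.Eventually.of_forall fun ω => hC ω i)
  have hpull : ∀ i, μ[(X ⁻¹' {i}).indicator (fun _ => (1 : ℝ)) * (fun ω => h ω i) | m'] =ᵐ[μ]
      fun ω => w ω i * h ω i := fun i =>
    (condExp_mul_of_stronglyMeasurable_right (hm i).stronglyMeasurable (hmul i) (hind i)).trans
      ((hw i).mul Filter.EventuallyEq.rfl)
  simp only [apply_eq_sum_indicator X h]
  rw [integral_finsetSum _ fun i _ => hmul i,
    integral_finsetSum _ fun i _ => integrable_condExp.congr (hpull i)]
  refine Finset.sum_congr rfl fun i _ => ?_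
  rw [← integral_congr_ae (hpull i), integral_condExp hle]
  rfl

end Sampling

/-! ### Expected regret relative to a face. -/

section Run

variable {Ω : Type*} [MeasurableSpace Ω] {K : ℕ} [NeZero K]

/-- The cumulative loss estimate before round `t + 1` as a random variable. -/
def estimate (loss : ℕ → Ω → Fin K → ℝ) (J : ℕ → Ω → Fin K) (t : ℕ) (ω : Ω) : Fin K → ℝ :=
  cumEst (fun s => J s ω) (fun s => loss s ω (J s ω)) t

theorem measurable_estimate_of {Ω : Type*} {m' : MeasurableSpace Ω} {loss : ℕ → Ω → Fin K → ℝ}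
    {J : ℕ → Ω → Fin K} {t : ℕ} (hJ : ∀ s < t, Measurable[m'] (J s))
    (hy : ∀ s < t, Measurable[m'] fun ω => loss s ω (J s ω)) :
    Measurable[m'] (estimate loss J t) := by
  induction t with
  | zero => exact measurable_const
  | succ t ih =>
    have h := ih (fun s hs => hJ s (hs.trans (Nat.lt_succ_self t)))
      (fun s hs => hy s (hs.trans (Nat.lt_succ_self t)))
    refine @measurable_pi_lambda Ω (Fin K) (fun _ => ℝ) m' _ _ fun i => ?_
    have h1 : Measurable[m'] fun ω => estimate loss J t ω i := (measurable_pi_apply i).comp h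
    have h2 : Measurable[m'] fun ω => explore (ftrl t (estimate loss J t ω)) i :=
      (continuous_explore t i).measurable.comp h
    have h3 : MeasurableSet[m'] {ω | J t ω = i} :=
      hJ t (Nat.lt_succ_self t) (measurableSet_singleton i)
    exact h1.add (Measurable.ite h3 ((hy t (Nat.lt_succ_self t)).div h2) measurable_const)

variable {μ : Measure Ω} {T : ℕ} {𝓕 : Filtration ℕ ‹MeasurableSpace Ω›}
  {loss : ℕ → Ω → Fin K → ℝ} {I J : ℕ → Ω → Fin K}

namespace IsRun

/-- The information about round `t + 1` that does not involve the draws of the learner: the history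
and the current losses. -/
abbrev info (𝓕 : Filtration ℕ ‹MeasurableSpace Ω›) (loss : ℕ → Ω → Fin K → ℝ) (t : ℕ) :
    MeasurableSpace Ω :=
  𝓕 t ⊔ MeasurableSpace.comap (loss t) inferInstance

theorem info_le (h : IsRun μ T 𝓕 loss I J) {t : ℕ} (ht : t < T) :
    info 𝓕 loss t ≤ ‹MeasurableSpace Ω› :=
  sup_le (𝓕.le t) (h.measurable_loss t ht).comap_le

theorem measurable_estimate (h : IsRun μ T 𝓕 loss I J) {t : ℕ} (ht : t < T) :
    Measurable[𝓕 t] (estimate loss J t) :=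
  measurable_estimate_of (h.history_explore t ht) (h.history_feedback t ht)

theorem measurable_loss_apply {K : ℕ} {loss : ℕ → Ω → Fin K → ℝ} {t : ℕ} (i : Fin K) :
    Measurable[info 𝓕 loss t] fun ω => loss t ω i :=
  ((measurable_pi_apply i).comp (comap_measurable (loss t))).mono le_sup_right le_rfl

theorem measurable_comp_estimate (h : IsRun μ T 𝓕 loss I J) {t : ℕ} (ht : t < T)
    {φ : (Fin K → ℝ) → ℝ} (hφ : Continuous φ) : Measurable[𝓕 t] fun ω => φ (estimate loss J t ω) :=
  hφ.measurable.comp (h.measurable_estimate ht)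

theorem exists_abs_comp_estimate_le (h : IsRun μ T 𝓕 loss I J) {t : ℕ} (ht : t < T)
    {φ : Fin K → (Fin K → ℝ) → ℝ} (hφ : ∀ i, Continuous (φ i)) :
    ∃ C, ∀ ω i, |φ i (estimate loss J t ω)| ≤ C := by
  obtain ⟨M, hM⟩ := exists_cumEst_le (K := K) t
  have hb : ∀ i, ∃ C, ∀ L ∈ Set.Icc (0 : Fin K → ℝ) (fun _ => M), |φ i L| ≤ C := by
    intro i
    obtain ⟨C, hC⟩ := (isCompact_Icc (a := (0 : Fin K → ℝ)) (b := fun _ => M)).bddAbove_image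
      (hφ i).abs.continuousOn
    exact ⟨C, fun L hL => hC ⟨L, hL, rfl⟩⟩
  choose C hC using hb
  refine ⟨∑ i, |C i|, fun ω i => ?_⟩
  have h1 := hM (fun s => J s ω) (fun s => loss s ω (J s ω))
    (fun s hs => h.loss_mem s (hs.trans ht) ω _)
  refine (hC i (estimate loss J t ω) ⟨fun k => (h1 k).1, fun k => (h1 k).2⟩).trans
    ((le_abs_self _).trans ?_)
  exact Finset.single_le_sum (f := fun k => |C k|) (fun k _ => abs_nonneg _) (Finset.mem_univ i)

theorem abs_loss_le (h : IsRun μ T 𝓕 loss I J) {t : ℕ} (ht : t < T) (ω : Ω) (i : Fin K) :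
    |loss t ω i| ≤ 1 := by
  have := h.loss_mem t ht ω i
  rw [abs_of_nonneg this.1]
  exact this.2

theorem abs_loss_sub_le (h : IsRun μ T 𝓕 loss I J) {t : ℕ} (ht : t < T) (ω : Ω) (i k : Fin K) :
    |loss t ω i - loss t ω k| ≤ 1 := by
  have h1 := h.loss_mem t ht ω i
  have h2 := h.loss_mem t ht ω k
  rw [abs_le]
  exact ⟨by linarith [h1.1, h2.2], by linarith [h1.2, h2.1]⟩

theorem measurable_loss_apply' (h : IsRun μ T 𝓕 loss I J) {t : ℕ} (ht : t < T) (i : Fin K) :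
    Measurable fun ω => loss t ω i :=
  (measurable_pi_apply i).comp (h.measurable_loss t ht)

theorem integrable_iSup_condExp {K : ℕ} {loss : ℕ → Ω → Fin K → ℝ} {t : ℕ} (k : Fin K)
    (Δ : Fin K → ℝ) :
    Integrable (fun ω => ⨆ i : {i : Fin K // Δ i = 0},
      (μ[fun ω' => loss t ω' i - loss t ω' k | 𝓕 t]) ω) μ := by
  have hm : Measurable fun ω => ⨆ i : {i : Fin K // Δ i = 0},
      (μ[fun ω' => loss t ω' i - loss t ω' k | 𝓕 t]) ω :=
    Measurable.iSup fun i => stronglyMeasurable_condExp.measurable.mono (𝓕.le t) le_rfl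
  refine Integrable.mono' (g := fun ω => ∑ i : {i : Fin K // Δ i = 0},
    |(μ[fun ω' => loss t ω' i - loss t ω' k | 𝓕 t]) ω|)
    (integrable_finsetSum _ fun i _ => integrable_condExp.abs) hm.aestronglyMeasurable
    (Filter.Eventually.of_forall fun ω => ?_)
  have hle : ∀ i : {i : Fin K // Δ i = 0},
      |(μ[fun ω' => loss t ω' i - loss t ω' k | 𝓕 t]) ω| ≤
      ∑ i : {i : Fin K // Δ i = 0}, |(μ[fun ω' => loss t ω' i - loss t ω' k | 𝓕 t]) ω| := fun i =>
    Finset.single_le_sum (f := fun i : {i : Fin K // Δ i = 0} =>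
      |(μ[fun ω' => loss t ω' i - loss t ω' k | 𝓕 t]) ω|) (fun _ _ => abs_nonneg _)
      (Finset.mem_univ i)
  rw [Real.norm_eq_abs]
  rcases isEmpty_or_nonempty {i : Fin K // Δ i = 0} with hE | ⟨⟨i⟩⟩
  -- The supremum of an empty family of reals is `0`, as the convention for the maximum demands.
  · rw [Real.iSup_of_isEmpty, abs_zero]
    exact Finset.sum_nonneg fun _ _ => abs_nonneg _
  · have : Nonempty {i : Fin K // Δ i = 0} := ⟨i⟩
    refine abs_le.2 ⟨?_, ciSup_le fun i => (le_abs_self _).trans (hle i)⟩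
    exact (neg_le.1 ((neg_le_abs _).trans (hle i))).trans
      (le_ciSup (f := fun i : {i : Fin K // Δ i = 0} =>
        (μ[fun ω' => loss t ω' i - loss t ω' k | 𝓕 t]) ω) (Set.finite_range _).bddAbove i)

theorem zeroGapDeviation_eq_sum {K : ℕ} {loss : ℕ → Ω → Fin K → ℝ} (k : Fin K) (Δ : Fin K → ℝ) :
    zeroGapDeviation μ T 𝓕 loss k Δ = ∑ t ∈ Finset.range T,
      ∫ ω, ⨆ i : {i : Fin K // Δ i = 0}, (μ[fun ω' => loss t ω' i - loss t ω' k | 𝓕 t]) ω ∂μ :=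
  integral_finsetSum _ fun _ _ => integrable_iSup_condExp k Δ

variable [IsProbabilityMeasure μ]

theorem integrable_comp_estimate (h : IsRun μ T 𝓕 loss I J) {t : ℕ} (ht : t < T)
    {φ : (Fin K → ℝ) → ℝ} (hφ : Continuous φ) :
    Integrable (fun ω => φ (estimate loss J t ω)) μ := by
  obtain ⟨C, hC⟩ := h.exists_abs_comp_estimate_le ht (φ := fun _ => φ) (fun _ => hφ)
  exact integrable_of_abs_le ((h.measurable_comp_estimate ht hφ).mono (𝓕.le t) le_rfl)
    fun ω => hC ω 0

theorem integrable_loss_sub (h : IsRun μ T 𝓕 loss I J) {t : ℕ} (ht : t < T) (i k : Fin K) :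
    Integrable (fun ω => loss t ω i - loss t ω k) μ :=
  integrable_of_abs_le ((h.measurable_loss_apply' ht i).sub (h.measurable_loss_apply' ht k))
    fun ω => h.abs_loss_sub_le ht ω i k

theorem integrable_comp_estimate_mul_loss_sub (h : IsRun μ T 𝓕 loss I J) {t : ℕ} (ht : t < T)
    {φ : (Fin K → ℝ) → ℝ} (hφ : Continuous φ) (i k : Fin K) :
    Integrable (fun ω => φ (estimate loss J t ω) * (loss t ω i - loss t ω k)) μ :=
  (h.integrable_comp_estimate ht hφ).mul_bdd
    (h.integrable_loss_sub ht i k).aestronglyMeasurable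
    (Filter.Eventually.of_forall fun ω => h.abs_loss_sub_le ht ω i k)

theorem integrable_comp_estimate_mul_loss (h : IsRun μ T 𝓕 loss I J) {t : ℕ} (ht : t < T)
    {φ : (Fin K → ℝ) → ℝ} (hφ : Continuous φ) (i : Fin K) :
    Integrable (fun ω => φ (estimate loss J t ω) * loss t ω i) μ :=
  (h.integrable_comp_estimate ht hφ).mul_bdd
    (h.measurable_loss_apply' ht i).aestronglyMeasurable
    (Filter.Eventually.of_forall fun ω => h.abs_loss_le ht ω i)

theorem integrable_exploit_loss (h : IsRun μ T 𝓕 loss I J) {t : ℕ} (ht : t < T) (k : Fin K) :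
    Integrable (fun ω => loss t ω (I t ω) - loss t ω k) μ :=
  integrable_of_abs_le ((measurable_apply_choice (h.measurable_exploit t ht)
    (h.measurable_loss_apply' ht)).sub (h.measurable_loss_apply' ht k))
    fun ω => h.abs_loss_sub_le ht ω _ k

theorem regret_eq_sum (h : IsRun μ T 𝓕 loss I J) (k : Fin K) :
    regret μ T loss I k =
      ∑ t ∈ Finset.range T, ∫ ω, (loss t ω (I t ω) - loss t ω k) ∂μ := by
  rw [regret, ← integral_finsetSum _ fun t ht =>
    h.integrable_exploit_loss (Finset.mem_range.1 ht) k]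
  simp only [Finset.sum_sub_distrib]

theorem regret_le_horizon (h : IsRun μ T 𝓕 loss I J) (k : Fin K) : regret μ T loss I k ≤ T := by
  rw [h.regret_eq_sum]
  calc _ ≤ ∑ t ∈ Finset.range T, (1 : ℝ) := by
        refine Finset.sum_le_sum fun t ht => ?_
        rw [Finset.mem_range] at ht
        calc _ ≤ ∫ _, (1 : ℝ) ∂μ := integral_mono (h.integrable_exploit_loss ht k)
              (integrable_const 1) fun ω => (abs_le.1 (h.abs_loss_sub_le ht ω _ k)).2
          _ = 1 := by simp
    _ = T := by simp

theorem weight_univ (t : ℕ) (L : Fin K → ℝ) (i : Fin K) :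
    weight Finset.univ (rate K t) L i = ftrl t L i := by
  rw [weight, if_pos (Finset.mem_univ i), ftrl_eq]

theorem sum_weight {U : Finset (Fin K)} (hU : U.Nonempty) (t : ℕ) (L : Fin K → ℝ) :
    ∑ i, weight U (rate K t) L i = 1 := by
  simp only [weight, Finset.sum_ite_mem, Finset.univ_inter]
  exact sum_root_cube hU (rate_pos t) L

theorem integral_exploit_loss (h : IsRun μ T 𝓕 loss I J) {t : ℕ} (ht : t < T) (k : Fin K) :
    ∫ ω, (loss t ω (I t ω) - loss t ω k) ∂μ =
      ∫ ω, ∑ i, ftrl t (estimate loss J t ω) i * (loss t ω i - loss t ω k) ∂μ :=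
  integral_apply_choice (h := fun ω i => loss t ω i - loss t ω k) (h.info_le ht)
    (h.measurable_exploit t ht) (h.law_exploit t ht)
    (fun i => (measurable_loss_apply i).sub (measurable_loss_apply k))
    (fun ω i => h.abs_loss_sub_le ht ω i k)

/-- The regret is the regret to FTRL on the face over `U` and the regret of the latter. -/
theorem regret_eq_add (h : IsRun μ T 𝓕 loss I J) {U : Finset (Fin K)} (hU : U.Nonempty)
    (k : Fin K) :
    regret μ T loss I k =
      ∑ t ∈ Finset.range T, ∫ ω, ∑ i, (weight Finset.univ (rate K t) (estimate loss J t ω) i -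
        weight U (rate K t) (estimate loss J t ω) i) * loss t ω i ∂μ +
      ∑ t ∈ Finset.range T, ∫ ω, ∑ i, weight U (rate K t) (estimate loss J t ω) i *
        (loss t ω i - loss t ω k) ∂μ := by
  rw [h.regret_eq_sum, ← Finset.sum_add_distrib]
  refine Finset.sum_congr rfl fun t ht => ?_
  rw [Finset.mem_range] at ht
  have hint : Integrable (fun ω => ∑ i, (weight Finset.univ (rate K t) (estimate loss J t ω) i -
      weight U (rate K t) (estimate loss J t ω) i) * loss t ω i) μ :=
    integrable_finsetSum _ fun i _ => h.integrable_comp_estimate_mul_loss ht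
      ((continuous_weight Finset.univ t i).sub (continuous_weight U t i)) i
  rw [h.integral_exploit_loss ht, ← integral_add hint
    (integrable_finsetSum _ fun i _ => h.integrable_comp_estimate_mul_loss_sub ht
      (continuous_weight U t i) i k)]
  congr 1
  funext ω
  -- Both distributions have mass one, so the loss of `k` cancels in their difference.
  have h1 := sum_weight (Finset.univ_nonempty (α := Fin K)) t (estimate loss J t ω)
  have h2 := sum_weight hU t (estimate loss J t ω)
  simp only [← weight_univ, mul_sub, sub_mul, Finset.sum_sub_distrib, ← Finset.sum_mul, h1, h2]
  ring

/-- The expected loss differences can be replaced by importance-weighted estimates. -/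
theorem integral_weight_sub_mul_loss (h : IsRun μ T 𝓕 loss I J) (U : Finset (Fin K)) {t : ℕ}
    (ht : t < T) :
    Integrable (fun ω => (weight Finset.univ (rate K t) (estimate loss J t ω) (J t ω) -
        weight U (rate K t) (estimate loss J t ω) (J t ω)) *
          (loss t ω (J t ω) / explore (ftrl t (estimate loss J t ω)) (J t ω))) μ ∧
    ∫ ω, (weight Finset.univ (rate K t) (estimate loss J t ω) (J t ω) -
        weight U (rate K t) (estimate loss J t ω) (J t ω)) *
          (loss t ω (J t ω) / explore (ftrl t (estimate loss J t ω)) (J t ω)) ∂μ =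
    ∫ ω, ∑ i, (weight Finset.univ (rate K t) (estimate loss J t ω) i -
        weight U (rate K t) (estimate loss J t ω) i) * loss t ω i ∂μ := by
  -- Averaging over the explored arm multiplies by `explore`, which cancels this divisor.
  set φ : Fin K → (Fin K → ℝ) → ℝ := fun i L =>
    (weight Finset.univ (rate K t) L i - weight U (rate K t) L i) / explore (ftrl t L) i with hφ
  have hφc : ∀ i, Continuous (φ i) := fun i =>
    ((continuous_weight Finset.univ t i).sub (continuous_weight U t i)).div
      (continuous_explore t i) fun L => (explore_pos t L i).ne'
  obtain ⟨C, hC⟩ := h.exists_abs_comp_estimate_le ht hφc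
  set F : Ω → Fin K → ℝ := fun ω i => φ i (estimate loss J t ω) * loss t ω i with hF
  have hFm : ∀ i, Measurable[info 𝓕 loss t] fun ω => F ω i := fun i =>
    ((h.measurable_comp_estimate ht (hφc i)).mono le_sup_left le_rfl).mul (measurable_loss_apply i)
  have hFC : ∀ ω i, |F ω i| ≤ C := fun ω i => by
    rw [hF, abs_mul]
    exact (mul_le_of_le_one_right (abs_nonneg _) (h.abs_loss_le ht ω i)).trans (hC ω i)
  have heq : (fun ω => (weight Finset.univ (rate K t) (estimate loss J t ω) (J t ω) -
        weight U (rate K t) (estimate loss J t ω) (J t ω)) *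
          (loss t ω (J t ω) / explore (ftrl t (estimate loss J t ω)) (J t ω))) =
      fun ω => F ω (J t ω) := by
    funext ω
    simp only [hF, hφ]
    ring
  rw [heq]
  constructor
  · exact integrable_of_abs_le (measurable_apply_choice (h.measurable_explore t ht)
      fun i => (hFm i).mono (h.info_le ht) le_rfl) fun ω => hFC ω _
  · rw [integral_apply_choice (h.info_le ht) (h.measurable_explore t ht) (h.law_explore t ht)
      hFm hFC]
    congr 1
    funext ω
    refine Finset.sum_congr rfl fun i _ => ?_
    have hg := (explore_pos t (estimate loss J t ω) i).ne'
    change explore (ftrl t (estimate loss J t ω)) i * _ = _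
    simp only [hF, hφ]
    field_simp

theorem integral_stabCoeff (h : IsRun μ T 𝓕 loss I J) {U : Finset (Fin K)} (hU : U.Nonempty)
    {t : ℕ} (ht : t < T) :
    Integrable (fun ω => stabCoeff U t (estimate loss J t ω) (J t ω) /
        explore (ftrl t (estimate loss J t ω)) (J t ω) ^ 2) μ ∧
    ∫ ω, stabCoeff U t (estimate loss J t ω) (J t ω) /
        explore (ftrl t (estimate loss J t ω)) (J t ω) ^ 2 ∂μ =
    ∫ ω, ∑ i, stabCoeff U t (estimate loss J t ω) i /
      explore (ftrl t (estimate loss J t ω)) i ∂μ := by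
  set φ : Fin K → (Fin K → ℝ) → ℝ := fun i L => stabCoeff U t L i / explore (ftrl t L) i ^ 2 with hφ
  have hφc : ∀ i, Continuous (φ i) := fun i =>
    (continuous_stabCoeff hU t i).div ((continuous_explore t i).pow 2)
      fun L => (pow_pos (explore_pos t L i) 2).ne'
  obtain ⟨C, hC⟩ := h.exists_abs_comp_estimate_le ht hφc
  set F : Ω → Fin K → ℝ := fun ω i => φ i (estimate loss J t ω) with hF
  have hFm : ∀ i, Measurable[info 𝓕 loss t] fun ω => F ω i := fun i =>
    (h.measurable_comp_estimate ht (hφc i)).mono le_sup_left le_rfl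
  constructor
  · exact integrable_of_abs_le (measurable_apply_choice (h.measurable_explore t ht)
      fun i => (hFm i).mono (h.info_le ht) le_rfl) fun ω => hC ω _
  · change ∫ ω, F ω (J t ω) ∂μ = _
    rw [integral_apply_choice (h.info_le ht) (h.measurable_explore t ht) (h.law_explore t ht)
      hFm hC]
    congr 1
    funext ω
    refine Finset.sum_congr rfl fun i _ => ?_
    have hg := (explore_pos t (estimate loss J t ω) i).ne'
    change explore (ftrl t (estimate loss J t ω)) i * _ = _
    simp only [hF, hφ]
    field_simp

/-- At most `K` rounds contribute, and `sixthRoot K ^ 3 = √K` matches the sum `2 * √K` of `t ^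
(-1/2)`. -/
theorem sum_early_rounds_le (K T : ℕ) :
    ∑ t ∈ Finset.range T, (if t + 1 < K then 2 * sixthRoot K ^ 3 / √((t : ℝ) + 1) else 0) ≤
      (4 * K : ℝ) := by
  have h6 : sixthRoot K ^ 6 = K := sixthRoot_pow
  have h0 : 0 ≤ sixthRoot K := Real.rpow_nonneg (Nat.cast_nonneg K) _
  calc ∑ t ∈ Finset.range T, (if t + 1 < K then 2 * sixthRoot K ^ 3 / √((t : ℝ) + 1) else 0)
      = ∑ t ∈ (Finset.range T).filter (fun t => t + 1 < K),
          2 * sixthRoot K ^ 3 / √((t : ℝ) + 1) := (Finset.sum_filter _ _).symm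
    _ ≤ ∑ t ∈ Finset.range K, 2 * sixthRoot K ^ 3 / √((t : ℝ) + 1) := by
        refine Finset.sum_le_sum_of_subset_of_nonneg (fun t ht => ?_) fun t _ _ => by positivity
        have := (Finset.mem_filter.1 ht).2
        exact Finset.mem_range.2 (by omega)
    _ = 2 * sixthRoot K ^ 3 * ∑ t ∈ Finset.range K, 1 / √((t : ℝ) + 1) := by
        rw [Finset.mul_sum]
        exact Finset.sum_congr rfl fun t _ => by ring
    _ ≤ 2 * sixthRoot K ^ 3 * (2 * √K) := by gcongr; exact sum_inv_sqrt_le K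
    _ = 4 * K := by
        have : √(K : ℝ) = sixthRoot K ^ 3 := by
          rw [Real.sqrt_eq_iff_mul_self_eq (Nat.cast_nonneg K) (by positivity), ← h6]
          ring
        rw [this, ← h6]
        ring

/-- The expected regret to FTRL on the face over `U` is governed by the arms outside of `U`. -/
theorem sum_integral_weight_sub_le (h : IsRun μ T 𝓕 loss I J) {U : Finset (Fin K)}
    (hU : U.Nonempty) :
    ∑ t ∈ Finset.range T, ∫ ω, ∑ i, (weight Finset.univ (rate K t) (estimate loss J t ω) i -
        weight U (rate K t) (estimate loss J t ω) i) * loss t ω i ∂μ ≤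
      ∑ t ∈ Finset.range T, 17 * sixthRoot K / √((t : ℝ) + 1) *
        ∫ ω, ∑ i ∈ Finset.univ \ U, armRoot t (estimate loss J t ω) i ^ 2 ∂μ + 25 * K := by
  have hκ := one_le_sixthRoot (K := K)
  have hint : ∀ t ∈ Finset.range T, Integrable (fun ω =>
      (weight Finset.univ (rate K t) (estimate loss J t ω) (J t ω) -
        weight U (rate K t) (estimate loss J t ω) (J t ω)) *
          (loss t ω (J t ω) / explore (ftrl t (estimate loss J t ω)) (J t ω))) μ :=
    fun t ht => (h.integral_weight_sub_mul_loss U (Finset.mem_range.1 ht)).1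
  have hcpen : ∀ t, Continuous fun L => penalty U t L := fun t =>
    (continuous_const.mul (continuous_sum_armRoot_pow t 2 _)).add continuous_const
  have hint2 : ∀ t ∈ Finset.range T, Integrable (fun ω =>
      stabCoeff U t (estimate loss J t ω) (J t ω) /
        explore (ftrl t (estimate loss J t ω)) (J t ω) ^ 2 +
          penalty U t (estimate loss J t ω)) μ := fun t ht =>
    (h.integral_stabCoeff hU (Finset.mem_range.1 ht)).1.add
      (h.integrable_comp_estimate (Finset.mem_range.1 ht) (hcpen t))
  have hs : ∀ t ∈ Finset.range T, Integrable (fun ω =>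
      ∑ i ∈ Finset.univ \ U, armRoot t (estimate loss J t ω) i ^ 2) μ := fun t ht =>
    h.integrable_comp_estimate (Finset.mem_range.1 ht) (continuous_sum_armRoot_pow t 2 _)
  have hround : ∀ t ∈ Finset.range T, ∫ ω, (stabCoeff U t (estimate loss J t ω) (J t ω) /
        explore (ftrl t (estimate loss J t ω)) (J t ω) ^ 2 +
          penalty U t (estimate loss J t ω)) ∂μ ≤
      17 * sixthRoot K / √((t : ℝ) + 1) *
        ∫ ω, ∑ i ∈ Finset.univ \ U, armRoot t (estimate loss J t ω) i ^ 2 ∂μ +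
      ((if t + 1 < K then 2 * sixthRoot K ^ 3 / √((t : ℝ) + 1) else 0) +
        6 * sixthRoot K ^ 3 * (1 / (((t : ℝ) + 1) * √((t : ℝ) + 1)))) := by
    intro t ht
    have ht' := Finset.mem_range.1 ht
    have hcoef : Integrable (fun ω => ∑ i, stabCoeff U t (estimate loss J t ω) i /
        explore (ftrl t (estimate loss J t ω)) i) μ :=
      integrable_finsetSum _ fun i _ => h.integrable_comp_estimate ht'
        ((continuous_stabCoeff hU t i).div (continuous_explore t i)
          fun L => (explore_pos t L i).ne')
    rw [integral_add (h.integral_stabCoeff hU ht').1 (h.integrable_comp_estimate ht' (hcpen t)),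
      (h.integral_stabCoeff hU ht').2, ← integral_add hcoef
        (h.integrable_comp_estimate ht' (hcpen t))]
    set c := (if t + 1 < K then 2 * sixthRoot K ^ 3 / √((t : ℝ) + 1) else 0) +
        6 * sixthRoot K ^ 3 * (1 / (((t : ℝ) + 1) * √((t : ℝ) + 1))) with hc
    have hrhs : 17 * sixthRoot K / √((t : ℝ) + 1) *
        ∫ ω, ∑ i ∈ Finset.univ \ U, armRoot t (estimate loss J t ω) i ^ 2 ∂μ + c =
        ∫ ω, (17 * sixthRoot K / √((t : ℝ) + 1) *
          ∑ i ∈ Finset.univ \ U, armRoot t (estimate loss J t ω) i ^ 2 + c) ∂μ := by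
      rw [integral_add ((hs t ht).const_mul _) (integrable_const c), integral_const_mul,
        integral_const]
      simp
    rw [hrhs]
    refine integral_mono (hcoef.add (h.integrable_comp_estimate ht' (hcpen t)))
      (((hs t ht).const_mul _).add (integrable_const c)) fun ω => ?_
    have h1 := sum_stabCoeff_div_le hU t (estimate loss J t ω)
    simp only [penalty, hc]
    have h2 : 17 * sixthRoot K / √((t : ℝ) + 1) *
          ∑ i ∈ Finset.univ \ U, armRoot t (estimate loss J t ω) i ^ 2 =
        14 * sixthRoot K / √((t : ℝ) + 1) *
          ∑ i ∈ Finset.univ \ U, armRoot t (estimate loss J t ω) i ^ 2 +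
        3 * sixthRoot K / √((t : ℝ) + 1) *
          ∑ i ∈ Finset.univ \ U, armRoot t (estimate loss J t ω) i ^ 2 := by ring
    rw [h2]
    linarith
  have h6 : sixthRoot K ^ 6 = K := sixthRoot_pow
  have h36 : sixthRoot K ^ 3 ≤ K := by
    rw [← h6]
    exact pow_le_pow_right₀ hκ (by norm_num)
  calc ∑ t ∈ Finset.range T, ∫ ω, ∑ i, (weight Finset.univ (rate K t) (estimate loss J t ω) i -
        weight U (rate K t) (estimate loss J t ω) i) * loss t ω i ∂μ
      = ∫ ω, ∑ t ∈ Finset.range T,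
        (weight Finset.univ (rate K t) (estimate loss J t ω) (J t ω) -
        weight U (rate K t) (estimate loss J t ω) (J t ω)) *
          (loss t ω (J t ω) / explore (ftrl t (estimate loss J t ω)) (J t ω)) ∂μ := by
        rw [integral_finsetSum _ hint]
        exact Finset.sum_congr rfl fun t ht =>
          (h.integral_weight_sub_mul_loss U (Finset.mem_range.1 ht)).2.symm
    _ ≤ ∫ ω, (∑ t ∈ Finset.range T, (stabCoeff U t (estimate loss J t ω) (J t ω) /
        explore (ftrl t (estimate loss J t ω)) (J t ω) ^ 2 +
          penalty U t (estimate loss J t ω)) + 3 * sixthRoot K ^ 3) ∂μ :=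
        integral_mono (integrable_finsetSum _ hint)
          ((integrable_finsetSum _ hint2).add (integrable_const _)) fun ω =>
          sum_weight_sub_le hU (fun s => J s ω) (fun s => loss s ω (J s ω)) T
            fun t ht => h.loss_mem t ht ω _
    _ = ∑ t ∈ Finset.range T, ∫ ω, (stabCoeff U t (estimate loss J t ω) (J t ω) /
        explore (ftrl t (estimate loss J t ω)) (J t ω) ^ 2 +
          penalty U t (estimate loss J t ω)) ∂μ + 3 * sixthRoot K ^ 3 := by
        rw [integral_add (integrable_finsetSum _ hint2) (integrable_const _),
          integral_finsetSum _ hint2, integral_const]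
        simp
    _ ≤ ∑ t ∈ Finset.range T, (17 * sixthRoot K / √((t : ℝ) + 1) *
        ∫ ω, ∑ i ∈ Finset.univ \ U, armRoot t (estimate loss J t ω) i ^ 2 ∂μ +
      ((if t + 1 < K then 2 * sixthRoot K ^ 3 / √((t : ℝ) + 1) else 0) +
        6 * sixthRoot K ^ 3 * (1 / (((t : ℝ) + 1) * √((t : ℝ) + 1))))) + 3 * sixthRoot K ^ 3 := by
        gcongr with t ht
        exact hround t ht
    _ ≤ _ := by
        -- `25 = 4 + 6 * 3 + 3`: early rounds, summed rate errors and initial value gap, the last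
        -- two with `sixthRoot K ^ 3 ≤ K`.
        rw [Finset.sum_add_distrib, Finset.sum_add_distrib, ← Finset.mul_sum]
        have h1 := sum_early_rounds_le K T
        have h2 := mul_le_mul_of_nonneg_left (sum_inv_mul_sqrt_le T)
          (show 0 ≤ 6 * sixthRoot K ^ 3 by positivity)
        linarith

/-- The maximum dominates any fixed gap-zero arm, whose expected cumulative loss is at least that of
the best arm. -/
theorem zeroGapDeviation_nonneg (h : IsRun μ T 𝓕 loss I J) {k : Fin K}
    (hk : IsBestArm μ T loss k) (Δ : Fin K → ℝ) : 0 ≤ zeroGapDeviation μ T 𝓕 loss k Δ := by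
  rw [zeroGapDeviation_eq_sum]
  rcases isEmpty_or_nonempty {i : Fin K // Δ i = 0} with hE | ⟨⟨i⟩⟩
  · simp [Real.iSup_of_isEmpty]
  · have hl : ∀ (i : Fin K), ∀ t ∈ Finset.range T, Integrable (fun ω => loss t ω i) μ :=
      fun i t ht => integrable_of_abs_le (h.measurable_loss_apply' (Finset.mem_range.1 ht) i)
        fun ω => h.abs_loss_le (Finset.mem_range.1 ht) ω i
    have h1 := hk i
    rw [integral_finsetSum _ (hl k), integral_finsetSum _ (hl i), ← sub_nonneg,
      ← Finset.sum_sub_distrib] at h1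
    refine h1.trans (Finset.sum_le_sum fun t ht => ?_)
    rw [← integral_sub (hl i t ht) (hl k t ht), ← integral_condExp (𝓕.le t)]
    exact integral_mono integrable_condExp (integrable_iSup_condExp k Δ) fun ω =>
      le_ciSup (f := fun i : {i : Fin K // Δ i = 0} =>
        (μ[fun ω' => loss t ω' i - loss t ω' k | 𝓕 t]) ω) (Set.finite_range _).bddAbove i

/-- FTRL on the face over the arms of gap zero has regret at most the deviation of these arms. -/
theorem sum_integral_weight_mul_le (h : IsRun μ T 𝓕 loss I J) (k : Fin K) (Δ : Fin K → ℝ)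
    {U : Finset (Fin K)} (hU : U.Nonempty) (hΔ : ∀ i ∈ U, Δ i = 0) :
    ∑ t ∈ Finset.range T, ∫ ω, ∑ i, weight U (rate K t) (estimate loss J t ω) i *
        (loss t ω i - loss t ω k) ∂μ ≤ zeroGapDeviation μ T 𝓕 loss k Δ := by
  rw [zeroGapDeviation_eq_sum]
  refine Finset.sum_le_sum fun t ht => ?_
  rw [Finset.mem_range] at ht
  have hmul : ∀ i, Integrable (fun ω => weight U (rate K t) (estimate loss J t ω) i *
      (loss t ω i - loss t ω k)) μ := fun i =>
    h.integrable_comp_estimate_mul_loss_sub ht (continuous_weight U t i) i k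
  -- The weights depend on the history only, so the losses may be replaced by their conditional
  -- expectations.
  have hpull : ∀ i, μ[(fun ω => weight U (rate K t) (estimate loss J t ω) i) *
      (fun ω => loss t ω i - loss t ω k) | 𝓕 t] =ᵐ[μ]
      fun ω => weight U (rate K t) (estimate loss J t ω) i *
        (μ[fun ω' => loss t ω' i - loss t ω' k | 𝓕 t]) ω := fun i =>
    condExp_mul_of_stronglyMeasurable_left
      (h.measurable_comp_estimate ht (continuous_weight U t i)).stronglyMeasurable (hmul i)
      (h.integrable_loss_sub ht i k)
  have heq : ∫ ω, ∑ i, weight U (rate K t) (estimate loss J t ω) i *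
        (loss t ω i - loss t ω k) ∂μ =
      ∫ ω, ∑ i, weight U (rate K t) (estimate loss J t ω) i *
        (μ[fun ω' => loss t ω' i - loss t ω' k | 𝓕 t]) ω ∂μ := by
    rw [integral_finsetSum _ fun i _ => hmul i,
      integral_finsetSum _ fun i _ => integrable_condExp.congr (hpull i)]
    refine Finset.sum_congr rfl fun i _ => ?_
    rw [← integral_congr_ae (hpull i), integral_condExp (𝓕.le t)]
    rfl
  rw [heq]
  refine integral_mono (integrable_finsetSum _ fun i _ => integrable_condExp.congr (hpull i))
    (integrable_iSup_condExp k Δ) fun ω => ?_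
  have h1 := sum_weight hU t (estimate loss J t ω)
  -- A convex combination supported on gap-zero arms is at most their maximum.
  rw [← one_mul (⨆ i : {i : Fin K // Δ i = 0}, _), ← h1, Finset.sum_mul]
  refine Finset.sum_le_sum fun i _ => ?_
  by_cases hi : i ∈ U
  · refine mul_le_mul_of_nonneg_left ?_ ?_
    · exact le_ciSup (f := fun i : {i : Fin K // Δ i = 0} =>
        (μ[fun ω' => loss t ω' i - loss t ω' k | 𝓕 t]) ω) (Set.finite_range _).bddAbove ⟨i, hΔ i hi⟩
    · rw [weight, if_pos hi]
      exact pow_nonneg (root_pos hU (rate_pos t) _ hi).le 3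
  · simp [weight, hi]

theorem weight_singleton_mul {K : ℕ} (k i : Fin K) (γ : ℝ) (L l : Fin K → ℝ) :
    weight {k} γ L i * (l i - l k) = 0 := by
  rw [weight]
  split_ifs with h
  · rw [Finset.mem_singleton.1 h, sub_self, mul_zero]
  · rw [zero_mul]

theorem regret_le_singleton (h : IsRun μ T 𝓕 loss I J) (k : Fin K) :
    regret μ T loss I k ≤ ∑ t ∈ Finset.range T, 17 * sixthRoot K / √((t : ℝ) + 1) *
        ∫ ω, ∑ i ∈ Finset.univ \ {k}, armRoot t (estimate loss J t ω) i ^ 2 ∂μ + 25 * K := by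
  rw [h.regret_eq_add (Finset.singleton_nonempty k) k]
  simp only [weight_singleton_mul k _ _ _ (loss _ _), Finset.sum_const_zero, integral_zero,
    add_zero]
  exact h.sum_integral_weight_sub_le (Finset.singleton_nonempty k)

end IsRun

end Run

/-! ### Scalar optimization for the self-bounding argument. -/

section Optimization

/-- A rescaling of `v² ≤ v³ + 1` at `v = m * u / b`. -/
theorem mul_sq_sub_mul_cube_le {b m u : ℝ} (hb : 0 < b) (hm : 0 < m) (hu : 0 ≤ u) :
    b * u ^ 2 - m * u ^ 3 ≤ b ^ 3 / m ^ 2 := by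
  have hv : ∀ v : ℝ, 0 ≤ v → v ^ 2 ≤ v ^ 3 + 1 := by
    intro v hv
    rcases le_total v 1 with h | h
    · nlinarith [pow_nonneg hv 3]
    · nlinarith [sq_nonneg v]
  have h := mul_le_mul_of_nonneg_left (hv (m * u / b) (by positivity))
    (show 0 ≤ b ^ 3 / m ^ 2 by positivity)
  have h1 : b ^ 3 / m ^ 2 * (m * u / b) ^ 2 = b * u ^ 2 := by field_simp
  have h2 : b ^ 3 / m ^ 2 * ((m * u / b) ^ 3 + 1) = m * u ^ 3 + b ^ 3 / m ^ 2 := by field_simp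
  rw [h1, h2] at h
  linarith

/-- The sum of `t ^ (-1/2)`, cut off by `Y t ^ (-3/2)`, is of order `√Y`. -/
theorem sum_le_sqrt_of_le_min {Y : ℝ} (hY : 0 < Y) {a : ℕ → ℝ}
    (h1 : ∀ t, a t ≤ 1 / √((t : ℝ) + 1))
    (h2 : ∀ t, a t ≤ Y * (1 / (((t : ℝ) + 1) * √((t : ℝ) + 1)))) (T : ℕ) :
    ∑ t ∈ Finset.range T, a t ≤ 5 * √Y := by
  have hsY : 0 < √Y := Real.sqrt_pos.2 hY
  have hsY2 : √Y ^ 2 = Y := Real.sq_sqrt hY.le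
  have hsmall : ∀ n : ℕ, ∑ t ∈ Finset.range n, a t ≤ 2 * √(n : ℝ) := fun n =>
    (Finset.sum_le_sum fun t _ => h1 t).trans (sum_inv_sqrt_le n)
  -- The first bound is used up to the crossover `n ≤ Y ≤ n + 1`, the second beyond it; the
  -- subtracted term is the reserve that pays for the tail.
  have hlarge : ∀ n : ℕ, Y ≤ n + 1 →
      ∑ t ∈ Finset.range (n + 1), a t ≤ 5 * √Y - 2 * Y / √((n : ℝ) + 1) := by
    have hcross : ∀ n : ℕ, (n : ℝ) ≤ Y → Y ≤ n + 1 →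
        ∑ t ∈ Finset.range (n + 1), a t ≤ 5 * √Y - 2 * Y / √((n : ℝ) + 1) := by
      intro n hn hn1
      have h3 : √(n : ℝ) ≤ √Y := Real.sqrt_le_sqrt hn
      have h4 : √Y ≤ √((n : ℝ) + 1) := Real.sqrt_le_sqrt hn1
      have h5 : Y / √((n : ℝ) + 1) ≤ √Y := by
        rw [div_le_iff₀ (hsY.trans_le h4)]
        nlinarith
      have h6 : Y * (1 / (((n : ℝ) + 1) * √((n : ℝ) + 1))) ≤ Y / √((n : ℝ) + 1) := by
        rw [mul_one_div]
        refine div_le_div_of_nonneg_left hY.le (hsY.trans_le h4) ?_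
        exact le_mul_of_one_le_left (Real.sqrt_nonneg _)
          (by linarith [Nat.cast_nonneg (α := ℝ) n])
      rw [Finset.sum_range_succ]
      have h7 := hsmall n
      have h8 := h2 n
      have h9 : 2 * Y / √((n : ℝ) + 1) = 2 * (Y / √((n : ℝ) + 1)) := mul_div_assoc _ _ _
      rw [h9]
      linarith
    intro n
    induction n with
    | zero =>
      intro hn
      exact hcross 0 (by simpa using hY.le) hn
    | succ n ih =>
      intro hn
      rcases le_total Y ((n : ℝ) + 1) with h | h
      · have h3 := ih h
        have h4 := h2 (n + 1)
        have h5 := mul_le_mul_of_nonneg_left (inv_mul_sqrt_le n) hY.le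
        rw [Finset.sum_range_succ]
        push_cast at h4 ⊢
        rw [add_assoc (n : ℝ) 1 1, one_add_one_eq_two] at h4 ⊢
        have h6 : Y * (2 / √((n : ℝ) + 1) - 2 / √((n : ℝ) + 2)) =
          2 * Y / √((n : ℝ) + 1) - 2 * Y / √((n : ℝ) + 2) := by ring
        linarith
      · exact hcross (n + 1) (by push_cast; exact h) hn
  rcases lt_or_ge (T : ℝ) Y with h | h
  · have h3 := hsmall T
    have h4 : √(T : ℝ) ≤ √Y := Real.sqrt_le_sqrt h.le
    linarith
  · cases T with
    | zero => simp
    | succ n =>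
      have h3 := hlarge n (by exact_mod_cast h)
      have h4 : 0 ≤ 2 * Y / √((n : ℝ) + 1) := by positivity
      linarith

/-- Optimizing the weight `η` of the self-bounding condition. -/
theorem le_of_forall_self_bounding {R Z C B b : ℝ} (hZ : 0 < Z) (hC : 0 ≤ C) (hb : 1 ≤ b)
    (h : ∀ η, 0 < η → η ≤ 1 → R ≤ b * √Z / η + B + η * C) :
    R ≤ 2 * b * (√Z + √C * Z ^ (1 / 4 : ℝ)) + B := by
  set z := Z ^ (1 / 4 : ℝ) with hz
  have hz0 : 0 < z := Real.rpow_pos_of_pos hZ _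
  have hsZ : √Z = z ^ 2 := by
    rw [hz, ← Real.rpow_natCast, ← Real.rpow_mul hZ.le, Real.sqrt_eq_rpow]
    norm_num
  have hc0 : 0 ≤ √C := Real.sqrt_nonneg C
  have hC2 : C = √C ^ 2 := (Real.sq_sqrt hC).symm
  set c := √C
  rw [hsZ] at h ⊢
  have hcz : 0 ≤ c * z := by positivity
  -- The choice is `η = 1` if `√C ≤ Z^(1/4)`, and otherwise `η = Z^(1/4) / √C`, which balances the
  -- two terms.
  rcases le_total c z with hcz1 | hcz1
  · have h1 := h 1 one_pos le_rfl
    rw [hC2] at h1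
    nlinarith [mul_nonneg hc0 (sub_nonneg.2 hcz1), mul_nonneg (sub_nonneg.2 hb) hcz,
      mul_nonneg (sub_nonneg.2 hb) (sq_nonneg z), sq_nonneg z]
  · have hcpos : 0 < c := hz0.trans_le hcz1
    have h1 := h (z / c) (by positivity) ((div_le_one hcpos).2 hcz1)
    have h2 : b * z ^ 2 / (z / c) = b * (c * z) := by field_simp
    have h3 : z / c * C = c * z := by rw [hC2]; field_simp
    rw [h2, h3] at h1
    nlinarith [mul_nonneg (sub_nonneg.2 hb) hcz, mul_nonneg (sub_nonneg.2 hb) (sq_nonneg z),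
      sq_nonneg z]

end Optimization

/-! ### The two regret bounds. -/

section Bounds

variable {Ω : Type*} [MeasurableSpace Ω] {K : ℕ} [NeZero K] {μ : Measure Ω}
  [IsProbabilityMeasure μ] {T : ℕ} {𝓕 : Filtration ℕ ‹MeasurableSpace Ω›}
  {loss : ℕ → Ω → Fin K → ℝ} {I J : ℕ → Ω → Fin K}

namespace IsRun

theorem regret_le_sqrt (h : IsRun μ T 𝓕 loss I J) (k : Fin K) :
    regret μ T loss I k ≤ 59 * √((K : ℝ) * T) := by
  have hκ := one_le_sixthRoot (K := K)
  have h6 : sixthRoot K ^ 6 = K := sixthRoot_pow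
  rcases le_total T K with hTK | hTK
  -- For `T ≤ K` the trivial bound `T` suffices. For `K ≤ T` the additive `25 * K` is absorbed, and
  -- `59 = 17 * 2 + 25`.
  · have h1 : (T : ℝ) ≤ √((K : ℝ) * T) := by
      refine Real.le_sqrt_of_sq_le ?_
      have : (T : ℝ) ≤ K := by exact_mod_cast hTK
      nlinarith [Nat.cast_nonneg (α := ℝ) T]
    linarith [h.regret_le_horizon k, Real.sqrt_nonneg ((K : ℝ) * T)]
  · have h1 : (K : ℝ) ≤ √((K : ℝ) * T) := by
      refine Real.le_sqrt_of_sq_le ?_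
      have : (K : ℝ) ≤ T := by exact_mod_cast hTK
      nlinarith [Nat.cast_nonneg (α := ℝ) K]
    have h2 : √((K : ℝ) * T) = sixthRoot K ^ 3 * √T := by
      rw [Real.sqrt_mul (Nat.cast_nonneg K)]
      congr 1
      rw [Real.sqrt_eq_iff_mul_self_eq (Nat.cast_nonneg K) (by positivity), ← h6]
      ring
    have h3 : ∑ t ∈ Finset.range T, 17 * sixthRoot K / √((t : ℝ) + 1) *
        ∫ ω, ∑ i ∈ Finset.univ \ {k}, armRoot t (estimate loss J t ω) i ^ 2 ∂μ ≤
        17 * sixthRoot K ^ 3 * (2 * √T) := by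
      calc _ ≤ ∑ t ∈ Finset.range T, 17 * sixthRoot K / √((t : ℝ) + 1) * sixthRoot K ^ 2 := by
            gcongr with t ht
            rw [Finset.mem_range] at ht
            calc _ ≤ ∫ _, sixthRoot K ^ 2 ∂μ := by
                  refine integral_mono (h.integrable_comp_estimate ht
                    (continuous_sum_armRoot_pow t 2 _)) (integrable_const _) fun ω => ?_
                  refine le_trans ?_ (sum_armRoot_sq_le t (estimate loss J t ω))
                  exact Finset.sum_le_sum_of_subset_of_nonneg (Finset.subset_univ _)
                    fun i _ _ => sq_nonneg _
              _ = _ := by simp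
        _ = 17 * sixthRoot K ^ 3 * ∑ t ∈ Finset.range T, 1 / √((t : ℝ) + 1) := by
            rw [Finset.mul_sum]
            exact Finset.sum_congr rfl fun t _ => by ring
        _ ≤ _ := by gcongr; exact sum_inv_sqrt_le T
    have h4 := h.regret_le_singleton k
    rw [h2] at h1 ⊢
    linarith

/-- The regret to FTRL on a face over `U`, where `U` contains all arms of gap zero, is compensated by
the gaps of the exploited arms up to the complexity. -/
theorem sum_sub_gap_le (h : IsRun μ T 𝓕 loss I J) {U : Finset (Fin K)} {Δ : Fin K → ℝ}
    (hΔ : ∀ i, Δ i ∈ Set.Icc (0 : ℝ) 1) (hU : ∀ i, Δ i = 0 → i ∈ U)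
    (hZ : 0 < complexity Δ) {η : ℝ} (hη : 0 < η) (hη1 : η ≤ 1) :
    (1 + η) * ∑ t ∈ Finset.range T, 17 * sixthRoot K / √((t : ℝ) + 1) *
        ∫ ω, ∑ i ∈ Finset.univ \ U, armRoot t (estimate loss J t ω) i ^ 2 ∂μ -
      η * ∫ ω, ∑ t ∈ Finset.range T, ∑ k,
        exploitDist (fun s => J s ω) (fun s => loss s ω (J s ω)) t k * Δ k ∂μ ≤
      5780 * √(complexity Δ) / η := by
  have hκ := one_le_sixthRoot (K := K)
  have h6 : sixthRoot K ^ 6 = K := sixthRoot_pow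
  set κ := sixthRoot K with hκd
  set X := ∑ i with Δ i ≠ 0, 1 / Δ i ^ 2 with hX
  have hZX : complexity Δ = κ ^ 6 * X := by
    rw [complexity, hX, Finset.mul_sum, h6]
    exact Finset.sum_congr rfl fun i _ => by ring
  have hX0 : 0 < X := by
    rw [hZX] at hZ
    exact (mul_pos_iff_of_pos_left (by positivity)).1 hZ
  -- The round where the `t ^ (-3/2)` bound overtakes the `t ^ (-1/2)` bound; `34 = 2 * 17` since `1
  -- + η ≤ 2`.
  set Y := 34 ^ 2 * X / η ^ 2 with hY
  have hY0 : 0 < Y := by positivity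
  set a : ℕ → ℝ := fun t => min (1 / √((t : ℝ) + 1))
    (Y * (1 / (((t : ℝ) + 1) * √((t : ℝ) + 1)))) with ha
  have hsum := sum_le_sqrt_of_le_min hY0 (a := a) (fun t => min_le_left _ _)
    (fun t => min_le_right _ _) T
  have hpoint : ∀ (t : ℕ) (L : Fin K → ℝ), (1 + η) * (17 * κ / √((t : ℝ) + 1)) *
      ∑ i ∈ Finset.univ \ U, armRoot t L i ^ 2 - η * ∑ k, ftrl t L k * Δ k ≤ 34 * κ ^ 3 * a t := by
    intro t L
    have hr : 0 < √((t : ℝ) + 1) := Real.sqrt_pos.2 (by positivity)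
    have hr2 : √((t : ℝ) + 1) ^ 2 = t + 1 := Real.sq_sqrt (by positivity)
    set b := 34 * κ / √((t : ℝ) + 1) with hb
    have hb0 : 0 < b := by positivity
    have hs0 : 0 ≤ ∑ i ∈ Finset.univ \ U, armRoot t L i ^ 2 :=
      Finset.sum_nonneg fun i _ => sq_nonneg _
    have hle : (1 + η) * (17 * κ / √((t : ℝ) + 1)) * ∑ i ∈ Finset.univ \ U, armRoot t L i ^ 2 ≤
        b * ∑ i ∈ Finset.univ \ U, armRoot t L i ^ 2 := by
      refine mul_le_mul_of_nonneg_right ?_ hs0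
      calc (1 + η) * (17 * κ / √((t : ℝ) + 1)) ≤ 2 * (17 * κ / √((t : ℝ) + 1)) :=
            mul_le_mul_of_nonneg_right (by linarith) (by positivity)
        _ = b := by rw [hb]; ring
    have hq : ∀ k, 0 ≤ ftrl t L k * Δ k := fun k => by
      rw [ftrl_eq]
      exact mul_nonneg (pow_nonneg (armRoot_pos t L k).le 3) (hΔ k).1
    have hκ3 : 0 < 34 * κ ^ 3 := by positivity
    rw [ha, mul_min_of_nonneg _ _ hκ3.le, le_min_iff]
    constructor
    · have h1 : 0 ≤ η * ∑ k, ftrl t L k * Δ k :=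
        mul_nonneg hη.le (Finset.sum_nonneg fun k _ => hq k)
      have h2 : ∑ i ∈ Finset.univ \ U, armRoot t L i ^ 2 ≤ κ ^ 2 :=
        (Finset.sum_le_sum_of_subset_of_nonneg (Finset.subset_univ _)
          fun i _ _ => sq_nonneg _).trans (sum_armRoot_sq_le t L)
      have h3 := mul_le_mul_of_nonneg_left h2 hb0.le
      have h4 : b * κ ^ 2 = 34 * κ ^ 3 * (1 / √((t : ℝ) + 1)) := by rw [hb]; ring
      linarith
    · have hsub : Finset.univ \ U ⊆ Finset.univ.filter (fun i => Δ i ≠ 0) := fun i hi =>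
        Finset.mem_filter.2 ⟨Finset.mem_univ i, fun h0 => (Finset.mem_sdiff.1 hi).2 (hU i h0)⟩
      have h1 : ∑ i ∈ Finset.univ \ U, armRoot t L i ^ 2 ≤
          ∑ i with Δ i ≠ 0, armRoot t L i ^ 2 :=
        Finset.sum_le_sum_of_subset_of_nonneg hsub fun i _ _ => sq_nonneg _
      have h2 : ∑ i with Δ i ≠ 0, ftrl t L i * Δ i ≤ ∑ k, ftrl t L k * Δ k :=
        Finset.sum_le_sum_of_subset_of_nonneg (Finset.filter_subset _ _) fun i _ _ => hq i
      have h3 : ∑ i with Δ i ≠ 0, (b * armRoot t L i ^ 2 - η * (ftrl t L i * Δ i)) ≤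
          ∑ i with Δ i ≠ 0, b ^ 3 / η ^ 2 * (1 / Δ i ^ 2) := by
        refine Finset.sum_le_sum fun i hi => ?_
        have hi0 : 0 < Δ i := lt_of_le_of_ne (hΔ i).1 (Finset.mem_filter.1 hi).2.symm
        have h4 := mul_sq_sub_mul_cube_le hb0 (mul_pos hη hi0) (armRoot_pos t L i).le
        rw [ftrl_eq]
        change b * armRoot t L i ^ 2 - η * (armRoot t L i ^ 3 * Δ i) ≤ _
        have h5 : b ^ 3 / η ^ 2 * (1 / Δ i ^ 2) = b ^ 3 / (η * Δ i) ^ 2 := by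
          field_simp
        rw [h5]
        linarith
      rw [Finset.sum_sub_distrib, ← Finset.mul_sum, ← Finset.mul_sum, ← Finset.mul_sum] at h3
      have h6 := mul_le_mul_of_nonneg_left h1 hb0.le
      have h7 := mul_le_mul_of_nonneg_left h2 hη.le
      have h8 : b ^ 3 / η ^ 2 * X =
          34 * κ ^ 3 * (Y * (1 / (((t : ℝ) + 1) * √((t : ℝ) + 1)))) := by
        have h9 : ((t : ℝ) + 1) * √((t : ℝ) + 1) = √((t : ℝ) + 1) ^ 3 := by rw [pow_succ, hr2]
        rw [h9, hb, hY]
        field_simp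
      rw [← h8]
      linarith
  have hi1 : ∀ t ∈ Finset.range T, Integrable (fun ω =>
      ∑ i ∈ Finset.univ \ U, armRoot t (estimate loss J t ω) i ^ 2) μ := fun t ht =>
    h.integrable_comp_estimate (Finset.mem_range.1 ht) (continuous_sum_armRoot_pow t 2 _)
  have hi2 : ∀ t ∈ Finset.range T, Integrable (fun ω =>
      ∑ k, ftrl t (estimate loss J t ω) k * Δ k) μ := fun t ht => by
    simp only [← weight_univ]
    exact integrable_finsetSum _ fun k _ =>
      (h.integrable_comp_estimate (Finset.mem_range.1 ht) (continuous_weight _ t k)).mul_const _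
  have hround : ∀ t ∈ Finset.range T, (1 + η) * (17 * κ / √((t : ℝ) + 1) *
        ∫ ω, ∑ i ∈ Finset.univ \ U, armRoot t (estimate loss J t ω) i ^ 2 ∂μ) -
      η * ∫ ω, ∑ k, ftrl t (estimate loss J t ω) k * Δ k ∂μ ≤ 34 * κ ^ 3 * a t := by
    intro t ht
    rw [← mul_assoc, ← integral_const_mul, ← integral_const_mul,
      ← integral_sub ((hi1 t ht).const_mul _) ((hi2 t ht).const_mul _)]
    calc _ ≤ ∫ _, 34 * κ ^ 3 * a t ∂μ :=
          integral_mono (((hi1 t ht).const_mul _).sub ((hi2 t ht).const_mul _))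
            (integrable_const _) fun ω => hpoint t _
      _ = _ := by simp
  have hexch : ∫ ω, ∑ t ∈ Finset.range T, ∑ k,
        exploitDist (fun s => J s ω) (fun s => loss s ω (J s ω)) t k * Δ k ∂μ =
      ∑ t ∈ Finset.range T, ∫ ω, ∑ k, ftrl t (estimate loss J t ω) k * Δ k ∂μ :=
    integral_finsetSum _ hi2
  rw [hexch, Finset.mul_sum, Finset.mul_sum, ← Finset.sum_sub_distrib]
  refine (Finset.sum_le_sum hround).trans ?_
  rw [← Finset.mul_sum]
  refine (mul_le_mul_of_nonneg_left hsum (by positivity)).trans (le_of_eq ?_)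
  have hs1 : √Y = 34 * √X / η := by
    rw [hY, Real.sqrt_div (by positivity), Real.sqrt_mul (by positivity),
      Real.sqrt_sq (by norm_num), Real.sqrt_sq hη.le]
  have hs2 : √(complexity Δ) = κ ^ 3 * √X := by
    rw [hZX, Real.sqrt_mul (by positivity)]
    congr 1
    rw [Real.sqrt_eq_iff_mul_self_eq (by positivity) (by positivity)]
    ring
  -- `5780 = 34 * 5 * 34`.
  rw [hs1, hs2]
  ring

theorem regret_le_add_zeroGapDeviation (h : IsRun μ T 𝓕 loss I J) {k : Fin K}
    (hk : IsBestArm μ T loss k) (Δ : Fin K → ℝ) : ∃ U : Finset (Fin K), (∀ i, Δ i = 0 → i ∈ U) ∧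
      regret μ T loss I k ≤ ∑ t ∈ Finset.range T, 17 * sixthRoot K / √((t : ℝ) + 1) *
        ∫ ω, ∑ i ∈ Finset.univ \ U, armRoot t (estimate loss J t ω) i ^ 2 ∂μ + 25 * K +
          zeroGapDeviation μ T 𝓕 loss k Δ := by
  rcases (Finset.univ.filter fun i => Δ i = 0).eq_empty_or_nonempty with hE | hU
  · refine ⟨{k}, fun i hi => ?_, ?_⟩
    · exact absurd hi (Finset.filter_eq_empty_iff.1 hE (Finset.mem_univ i))
    · linarith [h.regret_le_singleton k, h.zeroGapDeviation_nonneg hk Δ]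
  · refine ⟨_, fun i hi => Finset.mem_filter.2 ⟨Finset.mem_univ i, hi⟩, ?_⟩
    rw [h.regret_eq_add hU k]
    exact add_le_add (h.sum_integral_weight_sub_le hU)
      (h.sum_integral_weight_mul_le k Δ hU fun i hi => (Finset.mem_filter.1 hi).2)

theorem complexity_nonneg {K : ℕ} (Δ : Fin K → ℝ) : 0 ≤ complexity Δ :=
  Finset.sum_nonneg fun _ _ => by positivity

theorem eq_zero_of_complexity {Δ : Fin K → ℝ} (h : complexity Δ = 0) (i : Fin K) : Δ i = 0 := by
  by_contra hi
  have hK : (0 : ℝ) < K := by exact_mod_cast Nat.pos_of_ne_zero (NeZero.ne K)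
  have h1 := (Finset.sum_eq_zero_iff_of_nonneg fun i _ => by positivity).1 h i
    (Finset.mem_filter.2 ⟨Finset.mem_univ i, hi⟩)
  have h2 : 0 < (K : ℝ) / Δ i ^ 2 := by positivity
  exact h2.ne' h1

theorem regret_le_of_selfBounding (h : IsRun μ T 𝓕 loss I J) {k : Fin K}
    (hk : IsBestArm μ T loss k) {Δ : Fin K → ℝ} (hΔ : ∀ i, Δ i ∈ Set.Icc (0 : ℝ) 1) {C D : ℝ}
    (hC : 0 ≤ C) (hself : SelfBounding μ T loss I J k Δ C)
    (hD : zeroGapDeviation μ T 𝓕 loss k Δ ≤ D) :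
    regret μ T loss I k ≤
      11560 * (√(complexity Δ) + √C * complexity Δ ^ (1 / 4 : ℝ) + K + D) := by
  obtain ⟨U, hU, hreg⟩ := h.regret_le_add_zeroGapDeviation hk Δ
  have hD0 := (h.zeroGapDeviation_nonneg hk Δ).trans hD
  have hK0 : (0 : ℝ) ≤ K := Nat.cast_nonneg K
  -- Zero complexity means that all gaps vanish; then no arm lies outside `U` and only `25 * K + D`
  -- remains.
  rcases (complexity_nonneg Δ).eq_or_lt' with hZ | hZ
  · have hV : Finset.univ \ U = ∅ := by
      rw [Finset.sdiff_eq_empty_iff_subset]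
      exact fun i _ => hU i (eq_zero_of_complexity hZ i)
    simp only [hV, Finset.sum_empty, integral_zero, mul_zero, Finset.sum_const_zero] at hreg
    rw [hZ, Real.sqrt_zero, Real.zero_rpow (by norm_num), mul_zero]
    linarith
  · have hmain := le_of_forall_self_bounding (R := regret μ T loss I k) (B := 50 * K + 2 * D)
      (b := 5780) hZ hC (by norm_num) fun η hη hη1 => by
        -- The regret is written as `(1 + η) R - η R`: the upper bound goes into the first term, the
        -- self-bounding condition into the second.
        have h1 := h.sum_sub_gap_le hΔ hU hZ hη hη1
        have h2 := mul_le_mul_of_nonneg_left (hreg.trans (add_le_add_right hD _))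
          (show 0 ≤ 1 + η by linarith)
        have h3 := mul_le_mul_of_nonneg_left hself hη.le
        have h4 := mul_nonneg (sub_nonneg.2 hη1) (show 0 ≤ 25 * K + D by linarith)
        rw [mul_sub] at h3
        linarith
    linarith

end IsRun

end Bounds

end DEE

end

theorem theorem4 :
    ∃ c : ℝ, 0 < c ∧
      ∀ (K : ℕ) [NeZero K] (T : ℕ) {Ω : Type*} [MeasurableSpace Ω] (μ : Measure Ω)
        [IsProbabilityMeasure μ] (𝓕 : Filtration ℕ ‹MeasurableSpace Ω›)
        (loss : ℕ → Ω → Fin K → ℝ) (I J : ℕ → Ω → Fin K) (iStar : Fin K),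
        DEE.IsRun μ T 𝓕 loss I J →
        DEE.IsBestArm μ T loss iStar →
        DEE.regret μ T loss I iStar ≤ c * √((K : ℝ) * T) ∧
        ∀ (Δ : Fin K → ℝ) (C D : ℝ),
          (∀ i, Δ i ∈ Set.Icc (0 : ℝ) 1) → 0 ≤ C →
          DEE.SelfBounding μ T loss I J iStar Δ C →
          DEE.zeroGapDeviation μ T 𝓕 loss iStar Δ ≤ D →
          DEE.regret μ T loss I iStar ≤
            c * (√(DEE.complexity Δ) + √C * DEE.complexity Δ ^ (1 / 4 : ℝ) + K + D) := by
  -- `11560 = 2 * 5780`, the factor two coming from the optimization of `η`.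
  refine ⟨11560, by norm_num, fun K _ T Ω _ μ _ 𝓕 loss I J iStar h hbest => ⟨?_, ?_⟩⟩
  · exact (h.regret_le_sqrt iStar).trans
      (mul_le_mul_of_nonneg_right (by norm_num) (Real.sqrt_nonneg _))
  · intro Δ C D hΔ hC hself hD
    exact h.regret_le_of_selfBounding hbest hΔ hC hself hD
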